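/- **Setting.** Let $\mathcal X$ be a finite set, let $1\le n_0\le n$ and $k\ge1$ be integers, and let $\beta'\in(0,1)$. A growing dataset $\vec X=(X_1,\dots,X_n)$ consists of i.i.d. points from a distribution $\mathcal P$ on $\mathcal X$. A statistical query is a function $q:\mathcal X\to[0,1]$; its value on the snapshot $\vec x_{[t]}=(x_1,\dots,x_t)$ is $q(\vec x_{[t]})=\frac1t\sum_{\tau\le t}q(x_\tau)$, and $q(\mathcal P^t)=\mathbb E_{\vec X\sim\mathcal P^t}[q(\vec X)]$. In each round $t=n_0,\dots,n$ a randomized analyst, who sees only the transcript of past rounds, queries and responses, adaptively decides which statistical queries to ask and when to finish the round; the number of queries per round is thus chosen adaptively. The mechanism $\mathsf M_{\sigma,\rho}$ is the clipped Gaussian mechanism with constant noise level $\sigma>0$ tracked by a zCDP privacy filter with target level $\rho\ge 0$. It keeps a running privacy level $\bar\rho$, initially $0$. When a query $q$ is asked in round $t$, it sets $\bar\rho\leftarrow\bar\rho+\frac1{2\sigma^2t^2}$. If then $\bar\rho\le\rho$, it returns $r=\max(0,\min(q(\vec X_{[t]})+z,1))$ with fresh noise $z\sim\mathcal N(0,\sigma^2)$;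 otherwise it terminates the interaction. Say that $\mathsf M_{\sigma,\rho}$ is $(\alpha,\beta)$-*distributionally accurate for $k$ statistical queries* if for every distribution $\mathcal P$ on $\mathcal X$ and every analyst, with probability at least $1-\beta$ over the dataset, the analyst and the noise, each of the first $k$ responses released, $r$ to a query $q$ in a round $t$, satisfies $|r-q(\mathcal P^t)|\le\alpha$. (If the mechanism answers $k$ queries without terminating, these are all $k$ responses; if fewer than $k$ are released, the condition concerns those that are.) For $\rho\ge0$ and $\epsilon\ge0$ put $$\delta(\rho,\epsilon)=\inf_{\gamma\in(1,\infty)}\frac{e^{(\gamma-1)(\gamma\rho-\epsilon)}(1-\gamma^{-1})^{\gamma}}{\gamma-1},$$ let $\Theta=\{(\sigma,\beta,\epsilon)\in\mathbb R^3:\sigma>0,\ 0<\beta<1,\ \epsilon\ge0\}$, let $\operatorname{erfc}^{-1}$ be the inverse of the complementary error function, and put $$\lambda_\rho(\sigma,\beta,\epsilon)=\sqrt2\,\sigma\operatorname{erfc}^{-1}\!\Big(\frac\beta k\Big)+e^\epsilon-1+\frac{2n\,\delta(\rho,\epsilon)}{n_0\beta'}+\frac\beta{\beta'}+\frac2{\beta'}\sqrt{\frac{2\beta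 n\,\delta(\rho,\epsilon)}{n_0}}.$$ **Theorem.** Let the target level $\rho(\sigma)\ge0$ be chosen as any function (for instance a constant) of the noise level $\sigma>0$. 1. For every $\sigma>0$, the mechanism $\mathsf M_{\sigma,\rho(\sigma)}$ is $(\alpha',\beta')$-distributionally accurate for $k$ statistical queries with $\alpha'=\inf_{0<\beta<1,\ \epsilon\ge0}\lambda_{\rho(\sigma)}(\sigma,\beta,\epsilon)$. 2. Consequently, if $(\sigma^\star,\beta^\star,\epsilon^\star)$ minimizes $\lambda_{\rho(\sigma)}(\sigma,\beta,\epsilon)$ over $\Theta$, then the mechanism run with noise level $\sigma^\star$, $\mathsf M_{\sigma^\star,\rho(\sigma^\star)}$, is $(\alpha',\beta')$-distributionally accurate for $k$ statistical queries with $\alpha'=\min_{(\sigma,\beta,\epsilon)\in\Theta}\lambda_{\rho(\sigma)}(\sigma,\beta,\epsilon)$. -/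

import Mathlib

open MeasureTheory ProbabilityTheory

universe u v

noncomputable section

namespace GrowingADA

/-- A statistical query on the data domain `X`, given by its per-point function `X → [0, 1]`. -/
abbrev StatQuery (X : Type*) := X → unitInterval

/-- The value of a statistical query on a snapshot `y` of size `t`: the empirical average. -/
def snapshotValue {X : Type*} {t : ℕ} (q : StatQuery X) (y : Fin t → X) : ℝ :=
  (∑ τ, (q (y τ) : ℝ)) / t

/-- The value `q(P^t)` of a statistical query on the data distribution: the expected value of the
query on a snapshot of `t` i.i.d. points with law `P`. -/
def populationValue {X : Type*} [MeasurableSpace X] (P : Measure X) (t : ℕ) (q : StatQuery X) : ℝ :=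
  ∫ y : Fin t → X, snapshotValue q y ∂(Measure.pi fun _ : Fin t => P)

/-- One entry of a transcript: the round, the query asked in it, and the response. -/
abbrev Entry (X : Type*) := ℕ × StatQuery X × ℝ

/-- A randomised adaptive analyst. Its internal randomness is a seed in `Ω`. In round `t`, having
seen a transcript with `m` entries, it decides whether it is finished with the round, and if not
which query to ask next. It never sees the data. -/
structure Analyst (X Ω : Type*) [MeasurableSpace Ω] where
  finished : (t m : ℕ) → Ω × (Fin m → Entry X) → Bool
  query : (t m : ℕ) → Ω × (Fin m → Entry X) → StatQuery X
  measurable_finished : ∀ t m, Measurable (finished t m)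
  measurable_query : ∀ t m, Measurable (query t m)

/-- The state of the interaction: the transcript so far, the current round, the running privacy
level of the filter, and whether the filter has terminated the interaction. -/
structure State (X : Type*) where
  size : ℕ
  transcript : Fin size → Entry X
  round : ℕ
  spent : ℝ
  terminated : Bool

/-- Clamping to the unit interval. -/
def clamp (x : ℝ) : ℝ := max 0 (min x 1)

/-- The zCDP cost `1 / (2 σ_t² t²)` of a statistical query in round `t`. -/
def cost (sigma : ℕ → ℝ) (t : ℕ) : ℝ := 1 / (2 * sigma t ^ 2 * (t : ℝ) ^ 2)

/-- The state at the start: round `n₀`, empty transcript, nothing spent. -/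
def initState (X : Type*) (n₀ : ℕ) : State X := ⟨0, Fin.elim0, n₀, 0, false⟩

/-- One step of the interaction between the analyst `A` with seed `ω` and the clipped Gaussian
mechanism with round-dependent noise levels `sigma`, tracked by a zCDP privacy filter with target
level `ρ`, on the growing dataset `x`. The noise for the answer with index `m` is
`sigma t * z m`, with `z` a sequence of standard Gaussians. -/
def step {X Ω : Type*} [MeasurableSpace Ω] {n : ℕ} (sigma : ℕ → ℝ) (ρ : ℝ) (A : Analyst X Ω)
    (x : Fin n → X) (ω : Ω) (z : ℕ → ℝ) (s : State X) : State X :=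
  if s.terminated then s
  else if h : s.round ≤ n then
    if A.finished s.round s.size (ω, s.transcript) then { s with round := s.round + 1 }
    else if s.spent + cost sigma s.round ≤ ρ then
      let q := A.query s.round s.size (ω, s.transcript)
      let r := clamp (snapshotValue q (fun τ : Fin s.round => x (Fin.castLE h τ))
        + sigma s.round * z s.size)
      { size := s.size + 1
        transcript := Fin.snoc (α := fun _ => Entry X) s.transcript (s.round, q, r)
        round := s.round
        spent := s.spent + cost sigma s.round
        terminated := false }
    else { s with terminated := true }
  else s

/-- The state after `N` steps. -/
def stateAfter {X Ω : Type*} [MeasurableSpace Ω] {n : ℕ} (n₀ : ℕ) (sigma : ℕ → ℝ) (ρ : ℝ)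
    (A : Analyst X Ω) (x : Fin n → X) (ω : Ω) (z : ℕ → ℝ) (N : ℕ) : State X :=
  (step sigma ρ A x ω z)^[N] (initState X n₀)

/-- The joint law of the dataset (`n` i.i.d. points), the seed of the analyst, and the i.i.d.
standard Gaussian noise of the mechanism. -/
def jointLaw {X Ω : Type*} [MeasurableSpace X] [MeasurableSpace Ω] (n : ℕ) (P : Measure X)
    (μ : Measure Ω) : Measure ((Fin n → X) × Ω × (ℕ → ℝ)) :=
  (Measure.pi fun _ : Fin n => P).prod
    (μ.prod (Measure.infinitePi fun _ : ℕ => gaussianReal 0 1))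

/-- `(α, β)`-distributional accuracy for `k` statistical queries, on the data domain `X`, of the
clipped Gaussian mechanism with zCDP filter: for every data distribution and every analyst, the
probability that one of the first `k` released answers has distributional error more than `α` is
at most `β`. If the mechanism answers `k` queries without terminating, these are all `k` answers;
otherwise they are those released before the interaction ends. -/
def IsDistributionallyAccurate (X : Type u) [MeasurableSpace X] (n₀ n k : ℕ)
    (sigma : ℕ → ℝ) (ρ α β : ℝ) : Prop :=
  ∀ (P : Measure X) [IsProbabilityMeasure P]
    (Ω : Type v) [MeasurableSpace Ω] (μ : Measure Ω) [IsProbabilityMeasure μ] (A : Analyst X Ω),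
    jointLaw n P μ
      {w | ∃ N, ∃ i : Fin (stateAfter n₀ sigma ρ A w.1 w.2.1 w.2.2 N).size, (i : ℕ) < k ∧
        α < |((stateAfter n₀ sigma ρ A w.1 w.2.1 w.2.2 N).transcript i).2.2 -
          populationValue P
            ((stateAfter n₀ sigma ρ A w.1 w.2.1 w.2.2 N).transcript i).1
            ((stateAfter n₀ sigma ρ A w.1 w.2.1 w.2.2 N).transcript i).2.1|}
      ≤ ENNReal.ofReal β

/-- The complementary error function. -/
def erfc (x : ℝ) : ℝ := 2 / Real.sqrt Real.pi * ∫ u in Set.Ioi x, Real.exp (-u ^ 2)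

/-- The inverse of `erfc`, a bijection from `ℝ` to `(0, 2)`. -/
def erfcInv : ℝ → ℝ := Function.invFun erfc

/-- The `δ` for which `ρ`-zCDP is converted to `(ε, δ)`-differential privacy. -/
def deltaOf (ρ ε : ℝ) : ℝ :=
  ⨅ γ : Set.Ioi (1 : ℝ), Real.exp (((γ : ℝ) - 1) * (γ * ρ - ε)) *
    (1 - (γ : ℝ)⁻¹) ^ (γ : ℝ) / ((γ : ℝ) - 1)

/-- The error bound as a function of the noise level `σ` and the free parameters `β` and `ε`. -/
def errorBound (n₀ n k : ℕ) (ρ β' σ β ε : ℝ) : ℝ :=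
  Real.sqrt 2 * σ * erfcInv (β / k) + Real.exp ε - 1
    + 2 * n * deltaOf ρ ε / (n₀ * β') + β / β'
    + 2 / β' * Real.sqrt (2 * β * n * deltaOf ρ ε / n₀)

/-- The parameter set `Θ` of triples `(σ, β, ε)`. -/
def paramSet : Set (ℝ × ℝ × ℝ) := {θ | 0 < θ.1 ∧ 0 < θ.2.1 ∧ θ.2.1 < 1 ∧ 0 ≤ θ.2.2}

end GrowingADA

end

/-!
The transcript is a differentially private function of the dataset, so a query that is selected by
looking at the transcript alone has, in expectation, a value on the dataset that is close to its
value on the population. If an inaccurate response exists, select one and complement its query if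
necessary, so that the response overestimates the population value by more than `α`. Unless one of
the first `k` noise values is large, which has probability at most `β` by a union bound over
Gaussian tails, the value of the query on the snapshot then exceeds the population value by
`α - √2 σ erfc⁻¹(β / k)`. Comparing expectations bounds the probability of inaccuracy.

The selected round `t` is itself random. The value on the snapshot is therefore split into the
contributions of the `n` data points, each with weight at most `1 / t ≤ 1 / n₀`; this is the source
of the factor `n / n₀` of `δ`.

For the privacy of the adaptive interaction, fix two neighbouring datasets and resample the noise of
one response at a time. Moving from one dataset to the other shifts this noise by at most
`1 / (σ t)` standard deviations, which multiplies the likelihood ratio `a` of the responses by a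
factor with known `γ`-th moment. A bound by `exp ε` plus a multiple of `a ^ γ` is therefore
preserved at the expense of the budget that the filter charges, and optimizing `γ` gives `δ(ρ, ε)`.
-/

noncomputable section

namespace GrowingADA

open scoped ENNReal

section Resampling

variable {ι : Type*} [DecidableEq ι] {Y : ι → Type*} [∀ i, MeasurableSpace (Y i)]
  (μ : ∀ i, Measure (Y i)) [∀ i, IsProbabilityMeasure (μ i)] (i : ι)

theorem measurePreserving_update_infinitePi :
    MeasurePreserving (fun p : (∀ j, Y j) × Y i => Function.update p.1 i p.2)
      ((Measure.infinitePi μ).prod (μ i)) (Measure.infinitePi μ) := by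
  refine ⟨measurable_update', Measure.eq_infinitePi _ fun s t ht => ?_⟩
  have hpre : (fun p : (∀ j, Y j) × Y i => Function.update p.1 i p.2) ⁻¹' Set.pi s t
      = Set.pi (s.erase i) t ×ˢ {y | i ∈ s → y ∈ t i} := by
    ext ⟨x, y⟩
    simp only [Set.mem_preimage, Set.update_mem_pi_iff, Set.mem_prod, Finset.coe_erase,
      Finset.mem_coe, Set.mem_ofPred_eq]
  rw [Measure.map_apply measurable_update' (MeasurableSet.pi s.countable_toSet fun j _ => ht j),
    hpre, Measure.prod_prod, Measure.infinitePi_pi _ fun j _ => ht j]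
  by_cases hi : i ∈ s
  · simp only [hi, forall_const, Set.ofPred_mem_eq, Finset.prod_erase_mul]
  · simp only [hi, Finset.erase_eq_of_notMem hi, false_imp_iff, Set.ofPred_true, measure_univ,
      mul_one]

theorem lintegral_infinitePi_eq_lintegral_update {f : (∀ j, Y j) → ℝ≥0∞} (hf : Measurable f) :
    ∫⁻ x, f x ∂Measure.infinitePi μ
      = ∫⁻ x, ∫⁻ y, f (Function.update x i y) ∂μ i ∂Measure.infinitePi μ := by
  rw [← (measurePreserving_update_infinitePi μ i).lintegral_comp hf]
  exact lintegral_prod _ (hf.comp measurable_update').aemeasurable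

/- Drawing the `i`-th coordinate afresh twice makes the old and the new value of it exchangeable. -/
theorem measurePreserving_update_swap :
    MeasurePreserving (fun p : (∀ j, Y j) × Y i => (Function.update p.1 i p.2, p.1 i))
      ((Measure.infinitePi μ).prod (μ i)) ((Measure.infinitePi μ).prod (μ i)) := by
  have hswap := ((measurePreserving_prodAssoc (Measure.infinitePi μ) (μ i) (μ i)).symm).comp
    (((MeasurePreserving.id (Measure.infinitePi μ)).prod Measure.measurePreserving_swap).comp
      (measurePreserving_prodAssoc (Measure.infinitePi μ) (μ i) (μ i)))
  refine ((measurePreserving_update_infinitePi μ i).prod (MeasurePreserving.id (μ i))).of_semiconj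
    hswap (fun p => ?_) (measurable_update'.prodMk (by fun_prop))
  simp [MeasurableEquiv.prodAssoc]

end Resampling

section Gaussian

theorem lintegral_gaussianReal_add (c : ℝ) {g : ℝ → ℝ≥0∞} (hg : Measurable g) :
    ∫⁻ y, g (y + c) ∂gaussianReal 0 1
      = ∫⁻ y, ENNReal.ofReal (Real.exp (c * y - c ^ 2 / 2)) * g y ∂gaussianReal 0 1 := by
  rw [← lintegral_map hg (measurable_add_const c), gaussianReal_map_add_const,
    gaussianReal_of_var_ne_zero _ one_ne_zero, gaussianReal_of_var_ne_zero _ one_ne_zero,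
    lintegral_withDensity_eq_lintegral_mul _ (measurable_gaussianPDF _ _) hg,
    lintegral_withDensity_eq_lintegral_mul _ (measurable_gaussianPDF _ _) (by fun_prop)]
  refine lintegral_congr fun y => ?_
  simp only [Pi.mul_apply, gaussianPDF, ← mul_assoc,
    ← ENNReal.ofReal_mul (gaussianPDFReal_nonneg _ _ _)]
  congr 2
  simp only [gaussianPDFReal, NNReal.coe_one, mul_assoc, ← Real.exp_add]
  congr 3
  ring

theorem lintegral_gaussianReal_exp_rpow (c γ : ℝ) :
    ∫⁻ y, ENNReal.ofReal (Real.exp (c * y - c ^ 2 / 2) ^ γ) ∂gaussianReal 0 1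
      = ENNReal.ofReal (Real.exp (γ * (γ - 1) * (c ^ 2 / 2))) := by
  have hone : ∫⁻ y, ENNReal.ofReal (Real.exp (γ * c * y - (γ * c) ^ 2 / 2)) ∂gaussianReal 0 1
      = 1 := by
    simpa using (lintegral_gaussianReal_add (γ * c) (measurable_const (a := (1 : ℝ≥0∞)))).symm
  rw [← mul_one (ENNReal.ofReal (Real.exp (γ * (γ - 1) * (c ^ 2 / 2)))), ← hone,
    ← lintegral_const_mul _ (by fun_prop)]
  refine lintegral_congr fun y => ?_
  rw [← ENNReal.ofReal_mul (Real.exp_nonneg _), ← Real.exp_add, ← Real.exp_mul]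
  congr 2
  ring

theorem integrable_exp_neg_sq : Integrable fun u : ℝ => Real.exp (-u ^ 2) := by
  simpa using integrable_exp_neg_mul_sq one_pos

theorem erfc_nonneg (x : ℝ) : 0 ≤ erfc x :=
  mul_nonneg (by positivity) (integral_nonneg fun _ => Real.exp_nonneg _)

theorem erfc_antitone : Antitone erfc := fun x y hxy => by
  unfold erfc
  gcongr
  · exact Filter.Eventually.of_forall fun u => Real.exp_nonneg _
  · exact integrable_exp_neg_sq.integrableOn

theorem erfc_zero : erfc 0 = 1 := by
  have hIoi : ∫ u in Set.Ioi (0 : ℝ), Real.exp (-u ^ 2) = √Real.pi / 2 := by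
    simpa using integral_gaussian_Ioi 1
  rw [erfc, hIoi]
  field_simp

theorem erfc_eq_one_sub (x : ℝ) :
    erfc x = 1 - 2 / √Real.pi * ∫ u in (0 : ℝ)..x, Real.exp (-u ^ 2) := by
  rw [← intervalIntegral.integral_Ioi_sub_Ioi' integrable_exp_neg_sq.integrableOn
    integrable_exp_neg_sq.integrableOn, mul_sub, ← erfc_zero]
  simp only [erfc]
  ring

theorem continuous_erfc : Continuous erfc := by
  rw [funext erfc_eq_one_sub]
  exact continuous_const.sub (continuous_const.mul
    (intervalIntegral.continuous_primitive (fun _ _ => integrable_exp_neg_sq.intervalIntegrable) 0))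

theorem tendsto_erfc_atTop : Filter.Tendsto erfc Filter.atTop (nhds 0) := by
  have hprim := ((intervalIntegral_tendsto_integral_Ioi 0 integrable_exp_neg_sq.integrableOn
    Filter.tendsto_id).const_mul (2 / √Real.pi)).const_sub 1
  have hlim : 1 - 2 / √Real.pi * ∫ u in Set.Ioi (0 : ℝ), Real.exp (-u ^ 2) = 0 :=
    sub_eq_zero.2 erfc_zero.symm
  rw [hlim] at hprim
  rw [funext erfc_eq_one_sub]
  exact hprim

theorem erfc_erfcInv {b : ℝ} (h0 : 0 < b) (h1 : b ≤ 1) : erfc (erfcInv b) = b := by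
  obtain ⟨M, hM⟩ := (tendsto_erfc_atTop.eventually (gt_mem_nhds h0)).exists
  exact Function.invFun_eq (mem_range_of_exists_le_of_exists_ge continuous_erfc ⟨M, hM.le⟩
    ⟨0, h1.trans_eq erfc_zero.symm⟩)

theorem erfcInv_nonneg {b : ℝ} (h0 : 0 < b) (h1 : b < 1) : 0 ≤ erfcInv b := by
  refine (erfc_antitone.reflect_lt ?_).le
  rwa [erfc_erfcInv h0 h1.le, erfc_zero]

theorem gaussianReal_Ioi_sqrt_two_mul (u : ℝ) :
    gaussianReal 0 1 (Set.Ioi (√2 * u)) = ENNReal.ofReal (erfc u / 2) := by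
  rw [gaussianReal_apply_eq_integral _ one_ne_zero]
  congr 1
  have hscale : ∫ y in Set.Ioi (√2 * u), gaussianPDFReal 0 1 y
      = √2 * ∫ y in Set.Ioi u, gaussianPDFReal 0 1 (√2 * y) := by
    rw [integral_comp_mul_left_Ioi _ u (by positivity), smul_eq_mul,
      mul_inv_cancel_left₀ (by positivity)]
  rw [hscale, erfc, ← integral_const_mul, ← integral_const_mul, ← integral_div]
  congr 1
  ext y
  simp only [gaussianPDFReal, NNReal.coe_one, mul_one, sub_zero, mul_pow, Nat.ofNat_nonneg,
    Real.sq_sqrt]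
  rw [Real.sqrt_mul (by norm_num)]
  field_simp

theorem gaussianReal_sqrt_two_mul_lt_abs_le (u : ℝ) :
    gaussianReal 0 1 {y | √2 * u < |y|} ≤ ENNReal.ofReal (erfc u) := by
  have hneg : gaussianReal 0 1 (Neg.neg ⁻¹' Set.Ioi (√2 * u))
      = gaussianReal 0 1 (Set.Ioi (√2 * u)) := by
    rw [← Measure.map_apply measurable_neg measurableSet_Ioi, gaussianReal_map_neg, neg_zero]
  have hsplit : {y : ℝ | √2 * u < |y|}
      = Set.Ioi (√2 * u) ∪ Neg.neg ⁻¹' Set.Ioi (√2 * u) := by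
    ext y
    simp [lt_abs, lt_neg]
  rw [hsplit]
  refine (measure_union_le _ _).trans_eq ?_
  rw [hneg, gaussianReal_Ioi_sqrt_two_mul, ← ENNReal.ofReal_add (by linarith [erfc_nonneg u])
    (by linarith [erfc_nonneg u]), add_halves]

end Gaussian

section Renyi

variable {γ ε r : ℝ} {G G' : ℝ≥0∞}

/-- The coefficient of `a ^ γ` in the tangent-line bound of `a` by `exp ε` plus a multiple of
`a ^ γ`. It is the factor of `deltaOf ρ ε` that does not depend on `ρ`. -/
def renyiCoeff (γ ε : ℝ) : ℝ := Real.exp (-((γ - 1) * ε)) * (1 - γ⁻¹) ^ γ / (γ - 1)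

theorem renyiCoeff_nonneg (hγ : 1 < γ) : 0 ≤ renyiCoeff γ ε :=
  div_nonneg (mul_nonneg (Real.exp_nonneg _)
    (Real.rpow_nonneg (sub_nonneg.2 (inv_le_one_of_one_le₀ hγ.le)) _)) (sub_nonneg.2 hγ.le)

/- Bernoulli's inequality for `(1 - γ⁻¹) * (a * exp (-ε))`, that is, the tangent line of `b ^ γ` at
the point `b = (1 - γ⁻¹)⁻¹`. -/
theorem le_exp_add_renyiCoeff_mul_rpow {a : ℝ} (ha : 0 ≤ a) (hγ : 1 < γ) :
    a ≤ Real.exp ε + renyiCoeff γ ε * a ^ γ := by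
  have hγ1 : 0 < γ - 1 := sub_pos.2 hγ
  have hinv : 0 ≤ 1 - γ⁻¹ := sub_nonneg.2 (inv_le_one_of_one_le₀ hγ.le)
  obtain ⟨b, hb, rfl⟩ : ∃ b, 0 ≤ b ∧ a = b * Real.exp ε :=
    ⟨a * Real.exp (-ε), by positivity, by rw [mul_assoc, ← Real.exp_add]; simp⟩
  have hbernoulli : (γ - 1) * (b - 1) ≤ (1 - γ⁻¹) ^ γ * b ^ γ := by
    have h := one_add_mul_self_le_rpow_one_add (s := (1 - γ⁻¹) * b - 1) (p := γ)
      (by nlinarith [mul_nonneg hinv hb]) hγ.le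
    rw [add_sub_cancel, Real.mul_rpow hinv hb] at h
    refine le_of_eq_of_le ?_ h
    field_simp
    ring
  have hexp : Real.exp (-((γ - 1) * ε)) * Real.exp (ε * γ) = Real.exp ε := by
    rw [← Real.exp_add]
    ring_nf
  calc b * Real.exp ε
      = Real.exp ε + (γ - 1) * (b - 1) / (γ - 1) * Real.exp ε := by field_simp; ring
    _ ≤ Real.exp ε + (1 - γ⁻¹) ^ γ * b ^ γ / (γ - 1) * Real.exp ε := by gcongr
    _ = Real.exp ε + renyiCoeff γ ε * (b * Real.exp ε) ^ γ := by
      rw [Real.mul_rpow hb (Real.exp_nonneg _), ← Real.exp_mul, renyiCoeff]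
      linear_combination -(1 - γ⁻¹) ^ γ * b ^ γ / (γ - 1) * hexp

/-- The relation kept between the probabilities `G` and `G'` of an event on two neighbouring
datasets while a privacy budget `r` remains. The weight `a` stands for the likelihood ratio of the
responses released so far; quantifying over it makes the relation stable under one more adaptive
Gaussian response. At `a = 1` it is approximate differential privacy. -/
def RenyiDominated (γ ε r : ℝ) (G G' : ℝ≥0∞) : Prop :=
  ∀ a : ℝ, 0 ≤ a → ENNReal.ofReal a * G ≤ ENNReal.ofReal (Real.exp ε) * G'
    + ENNReal.ofReal (renyiCoeff γ ε * a ^ γ * Real.exp (γ * (γ - 1) * r))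

namespace RenyiDominated

theorem refl (hγ : 1 < γ) (hr : 0 ≤ r) (hG : G ≤ 1) : RenyiDominated γ ε r G G := fun a ha => by
  have hcoeff := mul_nonneg (renyiCoeff_nonneg (ε := ε) hγ) (Real.rpow_nonneg ha γ)
  have hbudget : 1 ≤ Real.exp (γ * (γ - 1) * r) :=
    Real.one_le_exp (mul_nonneg (mul_nonneg (by linarith) (by linarith)) hr)
  calc ENNReal.ofReal a * G
      ≤ (ENNReal.ofReal (Real.exp ε) + ENNReal.ofReal (renyiCoeff γ ε * a ^ γ)) * G := by
        rw [← ENNReal.ofReal_add (Real.exp_nonneg ε) hcoeff]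
        gcongr
        exact le_exp_add_renyiCoeff_mul_rpow ha hγ
    _ ≤ _ := by
        rw [add_mul]
        gcongr
        exact (mul_le_of_le_one_right' hG).trans
          (ENNReal.ofReal_le_ofReal (le_mul_of_one_le_right hcoeff hbudget))

theorem mono_budget {r' : ℝ} (h : RenyiDominated γ ε r G G') (hγ : 1 < γ) (hr : r ≤ r') :
    RenyiDominated γ ε r' G G' := fun a ha => by
  refine (h a ha).trans ?_
  have : 0 ≤ γ * (γ - 1) := mul_nonneg (by linarith) (by linarith)
  have hcoeff := mul_nonneg (renyiCoeff_nonneg (ε := ε) hγ) (Real.rpow_nonneg ha γ)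
  gcongr

/- The shift by `c` multiplies the likelihood ratio by `L y`, whose `γ`-th moment is
`exp (γ * (γ - 1) * (c ^ 2 / 2))`. -/
theorem lintegral_gaussianReal {g g' : ℝ → ℝ≥0∞} (c : ℝ) (hγ : 1 < γ) (hg : Measurable g)
    (h : ∀ y, RenyiDominated γ ε r (g y) (g' y)) :
    RenyiDominated γ ε (r + c ^ 2 / 2) (∫⁻ y, g (y + c) ∂gaussianReal 0 1)
      (∫⁻ y, g' y ∂gaussianReal 0 1) := fun a ha => by
  set L : ℝ → ℝ := fun y => Real.exp (c * y - c ^ 2 / 2) with hL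
  have hLm : Measurable L := by fun_prop
  have hcoeff : 0 ≤ renyiCoeff γ ε * a ^ γ * Real.exp (γ * (γ - 1) * r) :=
    mul_nonneg (mul_nonneg (renyiCoeff_nonneg hγ) (Real.rpow_nonneg ha γ)) (Real.exp_nonneg _)
  calc ENNReal.ofReal a * ∫⁻ y, g (y + c) ∂gaussianReal 0 1
      = ∫⁻ y, ENNReal.ofReal (a * L y) * g y ∂gaussianReal 0 1 := by
        rw [lintegral_gaussianReal_add c hg, ← lintegral_const_mul _ (by fun_prop)]
        simp only [ENNReal.ofReal_mul ha, mul_assoc, hL]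
    _ ≤ ∫⁻ y, (ENNReal.ofReal (Real.exp ε) * g' y + ENNReal.ofReal
          (renyiCoeff γ ε * a ^ γ * Real.exp (γ * (γ - 1) * r)) * ENNReal.ofReal (L y ^ γ))
          ∂gaussianReal 0 1 := by
        refine lintegral_mono fun y => (h y _ (by positivity)).trans_eq ?_
        rw [← ENNReal.ofReal_mul hcoeff, Real.mul_rpow ha (Real.exp_nonneg _ : 0 ≤ L y),
          ← mul_assoc, mul_right_comm (renyiCoeff γ ε * a ^ γ)]
    _ = _ := by
        rw [lintegral_add_right _ (by fun_prop), lintegral_const_mul' _ _ ENNReal.ofReal_ne_top,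
          lintegral_const_mul _ (by fun_prop), lintegral_gaussianReal_exp_rpow,
          ← ENNReal.ofReal_mul hcoeff, mul_assoc _ (Real.exp _), ← Real.exp_add, mul_add]

theorem le_add_deltaOf {ρ : ℝ} (h : ∀ γ, 1 < γ → RenyiDominated γ ε ρ G G') :
    G ≤ ENNReal.ofReal (Real.exp ε) * G' + ENNReal.ofReal (deltaOf ρ ε) := by
  rw [deltaOf, ENNReal.ofReal_iInf, ENNReal.add_iInf]
  refine le_iInf fun γ => ?_
  have hone := h γ γ.2 1 zero_le_one
  rw [ENNReal.ofReal_one, one_mul, Real.one_rpow, mul_one] at hone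
  refine hone.trans_eq ?_
  rw [renyiCoeff, div_mul_eq_mul_div, mul_right_comm, ← Real.exp_add]
  ring_nf

end RenyiDominated

theorem deltaOf_nonneg (ρ ε : ℝ) : 0 ≤ deltaOf ρ ε :=
  Real.iInf_nonneg fun γ => div_nonneg (mul_nonneg (Real.exp_nonneg _) (Real.rpow_nonneg
    (sub_nonneg.2 (inv_le_one_of_one_le₀ (le_of_lt γ.2))) _)) (sub_nonneg.2 (le_of_lt γ.2))

end Renyi

section Generalization

variable {ι X Ψ S : Type*} [MeasurableSpace Ψ] [MeasurableSpace S]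

theorem integral_mem_unitInterval {μ : Measure Ψ} [IsProbabilityMeasure μ] {f : Ψ → ℝ}
    (hf : ∀ ψ, f ψ ∈ unitInterval) : ∫ ψ, f ψ ∂μ ∈ unitInterval :=
  ⟨integral_nonneg fun ψ => (hf ψ).1,
    (integral_mono_of_nonneg (.of_forall fun ψ => (hf ψ).1) (integrable_const 1)
      (.of_forall fun ψ => (hf ψ).2)).trans_eq (by simp)⟩

theorem lintegral_ofReal_of_mem_unitInterval {μ : Measure Ψ} [IsFiniteMeasure μ] {f : Ψ → ℝ}
    (hfm : Measurable f) (hf : ∀ ψ, f ψ ∈ unitInterval) :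
    ∫⁻ ψ, ENNReal.ofReal (f ψ) ∂μ = ENNReal.ofReal (∫ ψ, f ψ ∂μ) :=
  (ofReal_integral_eq_lintegral_ofReal (.of_mem_Icc 0 1 hfm.aemeasurable (.of_forall hf))
    (.of_forall fun ψ => (hf ψ).1)).symm

/-- Approximate differential privacy of a randomized map `M` from datasets `x : ι → X` to `S`, with
randomness drawn from `ν`; neighbouring datasets differ in one coordinate. -/
def IsDifferentiallyPrivate [DecidableEq ι] (ν : Measure Ψ) (M : (ι → X) → Ψ → S) (ε δ : ℝ) :
    Prop :=
  ∀ (x : ι → X) (i : ι) (v : X) (D : Set S), MeasurableSet D →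
    ν {ψ | M x ψ ∈ D} ≤ ENNReal.ofReal (Real.exp ε) * ν {ψ | M (Function.update x i v) ψ ∈ D}
      + ENNReal.ofReal δ

namespace IsDifferentiallyPrivate

theorem lintegral_le [DecidableEq ι] {ν : Measure Ψ} {M : (ι → X) → Ψ → S} {ε δ : ℝ}
    (h : IsDifferentiallyPrivate ν M ε δ) (hM : ∀ x, Measurable (M x)) {g : S → ℝ}
    (hg : Measurable g) (hg01 : ∀ s, g s ∈ unitInterval) (x : ι → X) (i : ι) (v : X) :
    ∫⁻ ψ, ENNReal.ofReal (g (M x ψ)) ∂ν ≤ ENNReal.ofReal (Real.exp ε) *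
      ∫⁻ ψ, ENNReal.ofReal (g (M (Function.update x i v) ψ)) ∂ν + ENNReal.ofReal δ := by
  have hlayer (y : ι → X) : ∫⁻ ψ, ENNReal.ofReal (g (M y ψ)) ∂ν
      = ∫⁻ t in Set.Ioo 0 1, ν {ψ | t < g (M y ψ)} := by
    have hsupport : Function.support (fun t => ν {ψ | t < g (M y ψ)}) ⊆ Set.Iio 1 := fun t ht => by
      obtain ⟨ψ, hψ⟩ := nonempty_of_measure_ne_zero ht
      exact lt_of_lt_of_le hψ (hg01 _).2
    rw [lintegral_eq_lintegral_meas_lt ν (.of_forall fun ψ => (hg01 _).1)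
      (hg.comp (hM y)).aemeasurable, ← setLIntegral_eq_of_support_subset hsupport,
      Measure.restrict_restrict measurableSet_Iio, Set.inter_comm, Set.Ioi_inter_Iio]
  have hvol : volume (Set.Ioo (0 : ℝ) 1) = 1 := by simp
  calc ∫⁻ ψ, ENNReal.ofReal (g (M x ψ)) ∂ν
      ≤ ∫⁻ t in Set.Ioo 0 1, (ENNReal.ofReal (Real.exp ε)
          * ν {ψ | t < g (M (Function.update x i v) ψ)} + ENNReal.ofReal δ) := by
        rw [hlayer]
        exact lintegral_mono fun t => h x i v _ (measurableSet_lt measurable_const hg)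
    _ = _ := by
        rw [lintegral_add_right _ measurable_const,
          lintegral_const_mul' _ _ ENNReal.ofReal_ne_top, ← hlayer, setLIntegral_const, hvol,
          mul_one]

variable [MeasurableSpace X] {ν : Measure Ψ} [IsProbabilityMeasure ν] {ε δ : ℝ}

theorem lintegral_coordinate_le [Fintype ι] [DecidableEq ι] {M : (ι → X) → Ψ → S}
    (h : IsDifferentiallyPrivate ν M ε δ) (hM : Measurable (Function.uncurry M))
    (P : ι → Measure X) [∀ i, IsProbabilityMeasure (P i)] (i : ι) {f : S × X → ℝ}
    (hf : Measurable f) (hf01 : ∀ p, f p ∈ unitInterval) :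
    ∫⁻ w, ENNReal.ofReal (f (M w.1 w.2, w.1 i)) ∂(Measure.pi P).prod ν
      ≤ ENNReal.ofReal (Real.exp ε) *
        ∫⁻ w, ∫⁻ v, ENNReal.ofReal (f (M w.1 w.2, v)) ∂P i ∂(Measure.pi P).prod ν
        + ENNReal.ofReal δ := by
  set Φ : (ι → X) × X → ℝ≥0∞ := fun p => ∫⁻ ψ, ENNReal.ofReal (f (M p.1 ψ, p.2)) ∂ν with hΦ
  have hΦm : Measurable Φ := by
    refine Measurable.lintegral_prod_right' (f := fun p : ((ι → X) × X) × Ψ =>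
      ENNReal.ofReal (f (M p.1.1 p.2, p.1.2))) ?_
    exact (hf.comp ((hM.comp (by fun_prop : Measurable fun p : ((ι → X) × X) × Ψ =>
      (p.1.1, p.2))).prodMk (by fun_prop))).ennreal_ofReal
  have hprivate (x : ι → X) (v : X) :
      Φ (x, x i) ≤ ENNReal.ofReal (Real.exp ε) * Φ (Function.update x i v, x i)
        + ENNReal.ofReal δ :=
    h.lintegral_le (g := fun s => f (s, x i)) (fun x => hM.of_uncurry_left) (by fun_prop)
      (fun s => hf01 _) x i v
  have hexchange : ∫⁻ x, ∫⁻ v, Φ (Function.update x i v, x i) ∂P i ∂Measure.pi P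
      = ∫⁻ x, ∫⁻ v, Φ (x, v) ∂P i ∂Measure.pi P := by
    have hswap := measurePreserving_update_swap P i
    rw [Measure.infinitePi_eq_pi] at hswap
    exact (lintegral_lintegral (f := fun x v => Φ (Function.update x i v, x i))
      (hΦm.comp hswap.measurable).aemeasurable).trans
      ((hswap.lintegral_comp hΦm).trans (lintegral_prod _ hΦm.aemeasurable))
  calc ∫⁻ w, ENNReal.ofReal (f (M w.1 w.2, w.1 i)) ∂(Measure.pi P).prod ν
      = ∫⁻ x, ∫⁻ _v, Φ (x, x i) ∂P i ∂Measure.pi P := by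
        rw [lintegral_prod _ (by fun_prop)]
        simp only [lintegral_const, measure_univ, mul_one, hΦ]
    _ ≤ ∫⁻ x, ∫⁻ v, (ENNReal.ofReal (Real.exp ε) * Φ (Function.update x i v, x i)
          + ENNReal.ofReal δ) ∂P i ∂Measure.pi P :=
        lintegral_mono fun x => lintegral_mono fun v => hprivate x v
    _ = ENNReal.ofReal (Real.exp ε) * ∫⁻ x, ∫⁻ v, Φ (x, v) ∂P i ∂Measure.pi P
          + ENNReal.ofReal δ := by
        simp only [lintegral_add_right _ measurable_const, lintegral_const, measure_univ, mul_one,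
          lintegral_const_mul' _ _ ENNReal.ofReal_ne_top, hexchange]
    _ = _ := by
        rw [lintegral_prod _ (Measurable.lintegral_prod_right' (f := fun p : ((ι → X) × Ψ) × X =>
          ENNReal.ofReal (f (M p.1.1 p.1.2, p.2))) (by fun_prop)).aemeasurable]
        congr 2
        exact lintegral_congr fun x => lintegral_lintegral_swap (f := fun v ψ =>
          ENNReal.ofReal (f (M x ψ, v))) (by fun_prop)

theorem integral_coordinate_le [Fintype ι] [DecidableEq ι] {M : (ι → X) → Ψ → S}
    (h : IsDifferentiallyPrivate ν M ε δ) (hδ : 0 ≤ δ) (hM : Measurable (Function.uncurry M))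
    (P : ι → Measure X) [∀ i, IsProbabilityMeasure (P i)] (i : ι) {f : S × X → ℝ}
    (hf : Measurable f) (hf01 : ∀ p, f p ∈ unitInterval) :
    ∫ w, f (M w.1 w.2, w.1 i) ∂(Measure.pi P).prod ν
      ≤ Real.exp ε * ∫ w, ∫ v, f (M w.1 w.2, v) ∂P i ∂(Measure.pi P).prod ν + δ := by
  have hmean (w : (ι → X) × Ψ) : ∫ v, f (M w.1 w.2, v) ∂P i ∈ unitInterval :=
    integral_mem_unitInterval fun v => hf01 _
  have hmeasurable : Measurable fun w : (ι → X) × Ψ => ∫ v, f (M w.1 w.2, v) ∂P i :=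
    (StronglyMeasurable.integral_prod_right' (f := fun p : ((ι → X) × Ψ) × X =>
      f (M p.1.1 p.1.2, p.2)) (by fun_prop)).measurable
  have hle := h.lintegral_coordinate_le hM P i hf hf01
  have hinner (w : (ι → X) × Ψ) : ∫⁻ v, ENNReal.ofReal (f (M w.1 w.2, v)) ∂P i
      = ENNReal.ofReal (∫ v, f (M w.1 w.2, v) ∂P i) :=
    lintegral_ofReal_of_mem_unitInterval (by fun_prop) fun v => hf01 _
  simp only [hinner] at hle
  rw [lintegral_ofReal_of_mem_unitInterval (by fun_prop) fun w => hf01 _,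
    lintegral_ofReal_of_mem_unitInterval hmeasurable hmean, ← ENNReal.ofReal_mul (by positivity),
    ← ENNReal.ofReal_add (mul_nonneg (by positivity) (integral_mem_unitInterval hmean).1) hδ] at hle
  exact (ENNReal.ofReal_le_ofReal_iff (add_nonneg (mul_nonneg (by positivity)
    (integral_mem_unitInterval hmean).1) hδ)).1 hle

end IsDifferentiallyPrivate

end Generalization

section Queries

variable {X : Type*} {n t : ℕ}

/-- The value of a statistical query on the first `t` points of the dataset `x`. It agrees with
`snapshotValue` for `t ≤ n`, and avoids the dependence of `snapshotValue` on a proof of `t ≤ n`. -/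
def prefixValue (t : ℕ) (q : StatQuery X) (x : Fin n → X) : ℝ :=
  (∑ τ : Fin n, if (τ : ℕ) < t then (q (x τ) : ℝ) else 0) / t

theorem sum_ite_val_lt (ht : t ≤ n) (c : ℝ) :
    (∑ τ : Fin n, if (τ : ℕ) < t then c else 0) = t * c := by
  rw [← Finset.sum_filter, Finset.sum_const, Fin.card_filter_val_lt, min_eq_right ht, nsmul_eq_mul]

theorem snapshotValue_castLE (ht : t ≤ n) (q : StatQuery X) (x : Fin n → X) :
    snapshotValue q (fun τ : Fin t => x (Fin.castLE ht τ)) = prefixValue t q x := by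
  rw [snapshotValue, prefixValue, ← Finset.sum_filter]
  congr 1
  refine Finset.sum_bij (fun τ _ => Fin.castLE ht τ) (by simp) (by simp [Fin.ext_iff])
    (fun τ hτ => ⟨⟨τ, (Finset.mem_filter.1 hτ).2⟩, by simp⟩) (fun _ _ => rfl)

theorem prefixValue_nonneg (q : StatQuery X) (x : Fin n → X) : 0 ≤ prefixValue t q x :=
  div_nonneg (Finset.sum_nonneg fun τ _ => ite_nonneg (q (x τ)).2.1 le_rfl) (Nat.cast_nonneg t)

theorem prefixValue_symm (ht₀ : 1 ≤ t) (ht : t ≤ n) (q : StatQuery X) (x : Fin n → X) :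
    prefixValue t (fun v => unitInterval.symm (q v)) x = 1 - prefixValue t q x := by
  have ht' : (t : ℝ) ≠ 0 := by positivity
  have hsum := sum_ite_val_lt ht 1
  rw [mul_one] at hsum
  rw [eq_sub_iff_add_eq, prefixValue, prefixValue, ← add_div, ← Finset.sum_add_distrib,
    div_eq_one_iff_eq ht', ← hsum]
  refine Finset.sum_congr rfl fun τ _ => ?_
  split_ifs <;> simp

variable [MeasurableSpace X]

/-- The mean of a statistical query under the data distribution. -/
def queryMean (P : Measure X) (q : StatQuery X) : ℝ := ∫ v, (q v : ℝ) ∂P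

variable (P : Measure X) [IsProbabilityMeasure P] {q : StatQuery X}

theorem queryMean_mem_unitInterval (q : StatQuery X) : queryMean P q ∈ unitInterval :=
  integral_mem_unitInterval fun v => (q v).2

theorem integrable_statQuery (hq : Measurable q) : Integrable (fun v => (q v : ℝ)) P :=
  .of_mem_Icc 0 1 (measurable_subtype_coe.comp hq).aemeasurable (.of_forall fun v => (q v).2)

theorem queryMean_symm (hq : Measurable q) :
    queryMean P (fun v => unitInterval.symm (q v)) = 1 - queryMean P q := by
  simp only [queryMean, unitInterval.coe_symm_eq]
  rw [integral_sub (integrable_const _) (integrable_statQuery P hq), integral_const,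
    probReal_univ, one_smul]

theorem populationValue_eq_queryMean (ht : 1 ≤ t) (hq : Measurable q) :
    populationValue P t q = queryMean P q := by
  have hint := integrable_statQuery P hq
  have hcoord (τ : Fin t) : ∫ y : Fin t → X, (q (y τ) : ℝ) ∂(Measure.pi fun _ => P)
      = queryMean P q :=
    integral_comp_eval (μ := fun _ : Fin t => P) hint.aestronglyMeasurable
  have ht' : (t : ℝ) ≠ 0 := by positivity
  simp only [populationValue, snapshotValue]
  have hcoordInt (τ : Fin t) :
      Integrable (fun y : Fin t → X => (q (y τ) : ℝ)) (Measure.pi fun _ => P) :=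
    (measurePreserving_eval (fun _ : Fin t => P) τ).integrable_comp_of_integrable hint
  rw [integral_div, integral_finsetSum _ fun τ _ => hcoordInt τ]
  simp only [hcoord, Finset.sum_const, Finset.card_univ, Fintype.card_fin, nsmul_eq_mul]
  rw [mul_div_cancel_left₀ _ ht']

end Queries

section Selection

variable {X S : Type*} {n n₀ : ℕ} {D : Set S} {T : S → ℕ} {Q : S → StatQuery X}

/-- The contribution of one data point `p.2`, in position `i`, to `n₀` times the value of the query
`Q p.1` on the first `T p.1` points, where the query counts only on the event `D`. The factor `n₀`
brings the contribution into the unit interval when `n₀ ≤ T` on `D`. -/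
def contribution (D : Set S) (T : S → ℕ) (Q : S → StatQuery X) (n₀ i : ℕ) : S × X → ℝ :=
  {p | p.1 ∈ D ∧ i < T p.1}.indicator fun p => n₀ * Q p.1 p.2 / T p.1

theorem contribution_mem_unitInterval (hlow : ∀ s ∈ D, n₀ ≤ T s) (i : ℕ) (p : S × X) :
    contribution D T Q n₀ i p ∈ unitInterval := by
  by_cases hp : p.1 ∈ D ∧ i < T p.1
  · have hT : (n₀ : ℝ) ≤ T p.1 := mod_cast hlow p.1 hp.1
    have hQ := (Q p.1 p.2).2
    rw [contribution, Set.indicator_of_mem (s := {p : S × X | p.1 ∈ D ∧ i < T p.1}) hp]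
    exact ⟨div_nonneg (mul_nonneg n₀.cast_nonneg hQ.1) (Nat.cast_nonneg _),
      div_le_one_of_le₀ ((mul_le_of_le_one_right n₀.cast_nonneg hQ.2).trans hT)
        (Nat.cast_nonneg _)⟩
  · rw [contribution, Set.indicator_of_notMem (s := {p : S × X | p.1 ∈ D ∧ i < T p.1}) hp]
    exact unitInterval.zero_mem

theorem sum_contribution_data (x : Fin n → X) (s : S) :
    ∑ i : Fin n, contribution D T Q n₀ i (s, x i)
      = D.indicator (fun s => n₀ * prefixValue (T s) (Q s) x) s := by
  classical
  by_cases hs : s ∈ D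
  · simp only [contribution, Set.indicator_apply, Set.mem_ofPred_eq, hs, true_and, if_true,
      prefixValue, Finset.sum_div, Finset.mul_sum]
    refine Finset.sum_congr rfl fun i _ => ?_
    split_ifs <;> ring
  · simp only [contribution, Set.indicator_apply, Set.mem_ofPred_eq, hs, false_and, if_false,
      Finset.sum_const_zero]

variable [MeasurableSpace X]

theorem sum_integral_contribution (hpos : ∀ s ∈ D, 0 < T s) (hup : ∀ s ∈ D, T s ≤ n)
    (P : Measure X) (s : S) :
    ∑ i : Fin n, ∫ v, contribution D T Q n₀ i (s, v) ∂P
      = D.indicator (fun s => n₀ * queryMean P (Q s)) s := by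
  classical
  by_cases hs : s ∈ D
  · have hT : (T s : ℝ) ≠ 0 := mod_cast (hpos s hs).ne'
    have hterm (i : Fin n) : ∫ v, contribution D T Q n₀ i (s, v) ∂P
        = if (i : ℕ) < T s then n₀ * queryMean P (Q s) / T s else 0 := by
      simp only [contribution, Set.indicator_apply, Set.mem_ofPred_eq, hs, true_and]
      split_ifs
      · rw [integral_div, integral_const_mul, queryMean]
      · exact integral_zero _ _
    simp only [hterm, sum_ite_val_lt (hup s hs), Set.indicator_of_mem hs, mul_div_cancel₀ _ hT]
  · simp only [contribution, Set.indicator_apply, Set.mem_ofPred_eq, hs, false_and, if_false,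
      integral_zero, Finset.sum_const_zero]

variable {Ψ : Type*} [MeasurableSpace S] [MeasurableSpace Ψ] {ν : Measure Ψ}
  [IsProbabilityMeasure ν] {M : (Fin n → X) → Ψ → S} {ε δ : ℝ}

theorem measurable_contribution (hD : MeasurableSet D) (hT : Measurable T)
    (hQ : Measurable fun p : S × X => Q p.1 p.2) (i : ℕ) :
    Measurable (contribution D T Q n₀ i) := by
  refine Measurable.indicator (by fun_prop) ?_
  exact (measurable_fst hD).inter (measurableSet_lt measurable_const (hT.comp measurable_fst))

theorem mul_setIntegral_prefixValue {J : Measure ((Fin n → X) × Ψ)} [IsFiniteMeasure J]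
    (hM : Measurable (Function.uncurry M)) (hD : MeasurableSet D) (hT : Measurable T)
    (hQ : Measurable fun p : S × X => Q p.1 p.2) (hlow : ∀ s ∈ D, n₀ ≤ T s) :
    n₀ * ∫ w in {w | M w.1 w.2 ∈ D}, prefixValue (T (M w.1 w.2)) (Q (M w.1 w.2)) w.1 ∂J
      = ∑ i : Fin n, ∫ w, contribution D T Q n₀ i (M w.1 w.2, w.1 i) ∂J := by
  have hEm : MeasurableSet {w : (Fin n → X) × Ψ | M w.1 w.2 ∈ D} := hM hD
  have hMm : Measurable fun w : (Fin n → X) × Ψ => M w.1 w.2 := hM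
  have hcontr (i : ℕ) : Measurable (contribution D T Q n₀ i) := measurable_contribution hD hT hQ i
  have hint (i : Fin n) : Integrable (fun w => contribution D T Q n₀ i (M w.1 w.2, w.1 i)) J :=
    .of_mem_Icc 0 1 (by fun_prop) (.of_forall fun w => contribution_mem_unitInterval hlow i _)
  rw [← integral_finsetSum _ fun i _ => hint i, ← integral_const_mul, ← integral_indicator hEm]
  exact integral_congr_ae (.of_forall fun w => (sum_contribution_data w.1 (M w.1 w.2)).symm)

theorem mul_setIntegral_queryMean {J : Measure ((Fin n → X) × Ψ)} [IsFiniteMeasure J]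
    (P : Measure X) [IsProbabilityMeasure P] (hM : Measurable (Function.uncurry M))
    (hD : MeasurableSet D) (hT : Measurable T) (hQ : Measurable fun p : S × X => Q p.1 p.2)
    (hn₀ : 1 ≤ n₀) (hlow : ∀ s ∈ D, n₀ ≤ T s) (hup : ∀ s ∈ D, T s ≤ n) :
    n₀ * ∫ w in {w | M w.1 w.2 ∈ D}, queryMean P (Q (M w.1 w.2)) ∂J
      = ∑ i : Fin n, ∫ w, ∫ v, contribution D T Q n₀ i (M w.1 w.2, v) ∂P ∂J := by
  have hEm : MeasurableSet {w : (Fin n → X) × Ψ | M w.1 w.2 ∈ D} := hM hD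
  have hMm : Measurable fun w : (Fin n → X) × Ψ => M w.1 w.2 := hM
  have hcontr (i : ℕ) : Measurable (contribution D T Q n₀ i) := measurable_contribution hD hT hQ i
  have hmean (i : ℕ) : Measurable fun w : (Fin n → X) × Ψ =>
      ∫ v, contribution D T Q n₀ i (M w.1 w.2, v) ∂P :=
    (StronglyMeasurable.integral_prod_right' (f := fun p : ((Fin n → X) × Ψ) × X =>
      contribution D T Q n₀ i (M p.1.1 p.1.2, p.2)) (by fun_prop)).measurable
  rw [← integral_finsetSum _ fun (i : Fin n) _ => .of_mem_Icc 0 1 (hmean i).aemeasurable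
      (.of_forall fun w => integral_mem_unitInterval fun v =>
        contribution_mem_unitInterval hlow i _),
    ← integral_const_mul, ← integral_indicator hEm]
  exact integral_congr_ae (.of_forall fun w => (sum_integral_contribution
    (fun s hs => hn₀.trans (hlow s hs)) hup P (M w.1 w.2)).symm)

theorem IsDifferentiallyPrivate.setIntegral_prefixValue_le (h : IsDifferentiallyPrivate ν M ε δ)
    (hδ : 0 ≤ δ) (hM : Measurable (Function.uncurry M)) (P : Measure X) [IsProbabilityMeasure P]
    (hD : MeasurableSet D) (hT : Measurable T) (hQ : Measurable fun p : S × X => Q p.1 p.2)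
    (hn₀ : 1 ≤ n₀) (hlow : ∀ s ∈ D, n₀ ≤ T s) (hup : ∀ s ∈ D, T s ≤ n) :
    ∫ w in {w | M w.1 w.2 ∈ D}, prefixValue (T (M w.1 w.2)) (Q (M w.1 w.2)) w.1
        ∂(Measure.pi fun _ => P).prod ν
      ≤ Real.exp ε * ∫ w in {w | M w.1 w.2 ∈ D}, queryMean P (Q (M w.1 w.2))
        ∂(Measure.pi fun _ => P).prod ν + n * δ / n₀ := by
  have hpos : (0 : ℝ) < n₀ := mod_cast hn₀
  have hsum := Finset.sum_le_sum fun (i : Fin n) (_ : i ∈ Finset.univ) =>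
    h.integral_coordinate_le hδ hM (fun _ => P) i (measurable_contribution hD hT hQ i)
      (contribution_mem_unitInterval hlow i)
  rw [Finset.sum_add_distrib, ← Finset.mul_sum, ← mul_setIntegral_prefixValue hM hD hT hQ hlow,
    ← mul_setIntegral_queryMean P hM hD hT hQ hn₀ hlow hup, Finset.sum_const,
    Finset.card_univ, Fintype.card_fin, nsmul_eq_mul] at hsum
  refine le_of_mul_le_mul_left (hsum.trans_eq ?_) hpos
  field_simp

end Selection

section StateSpace

namespace State

variable {X W Y : Type*} [MeasurableSpace W] [MeasurableSpace Y] {m t : ℕ} {b : Bool}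

/-- The transcript of a state as an infinite sequence, of which only the first `size` entries are
meaningful. It gives the transcripts of all states a common type. -/
def entry (s : State X) (i : ℕ) : Entry X :=
  if h : i < s.size then s.transcript ⟨i, h⟩ else (0, fun _ => 0, 0)

theorem entry_val (s : State X) (i : Fin s.size) : s.entry i = s.transcript i :=
  dif_pos i.2

/-- The σ-algebra on states that is generated by their components. -/
instance : MeasurableSpace (State X) :=
  MeasurableSpace.comap (fun s => ((s.size, s.round, s.terminated), s.entry, s.spent)) inferInstance

theorem measurable_components :
    Measurable fun s : State X => ((s.size, s.round, s.terminated), s.entry, s.spent) :=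
  comap_measurable _

@[fun_prop] theorem measurable_size : Measurable (State.size (X := X)) :=
  measurable_components.fst.fst

@[fun_prop] theorem measurable_entry : Measurable (State.entry (X := X)) :=
  measurable_components.snd.fst

@[fun_prop] theorem measurable_mk {tr : W → Fin m → Entry X} {sp : W → ℝ} (htr : Measurable tr)
    (hsp : Measurable sp) : Measurable fun w => (⟨m, tr w, t, sp w, b⟩ : State X) := by
  have hentry : Measurable fun w => (⟨m, tr w, t, sp w, b⟩ : State X).entry := by
    refine measurable_pi_lambda _ fun i => ?_
    by_cases hi : i < m
    · simpa only [entry, hi, dif_pos] using htr.eval (a := ⟨i, hi⟩)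
    · simp only [entry, hi, dif_neg, not_false_eq_true]
      fun_prop
  exact measurable_comap_iff.2 ((measurable_const (a := (m, t, b))).prodMk (hentry.prodMk hsp))

theorem measurable_of_fibers {f : W × State X → Y} (hf : ∀ m t b, Measurable fun
      p : W × (Fin m → Entry X) × ℝ => f (p.1, ⟨m, p.2.1, t, p.2.2, b⟩)) : Measurable f := by
  have h : Measurable fun p : (ℕ × ℕ × Bool) × W × (ℕ → Entry X) × ℝ =>
      f (p.2.1, ⟨p.1.1, fun i => p.2.2.1 i, p.1.2.1, p.2.2.2, p.1.2.2⟩) :=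
    measurable_from_prod_countable_right fun c => (hf c.1 c.2.1 c.2.2).comp
      (by fun_prop : Measurable fun p : W × (ℕ → Entry X) × ℝ =>
        (p.1, (fun i : Fin c.1 => p.2.1 i), p.2.2))
  have heq : f = fun p => f (p.1, ⟨p.2.size, fun i => p.2.entry i, p.2.round, p.2.spent,
      p.2.terminated⟩) := by
    simp only [entry_val]
  rw [heq]
  exact h.comp (((measurable_components.comp measurable_snd).fst).prodMk
    (measurable_fst.prodMk (measurable_components.comp measurable_snd).snd))

end State

end StateSpace

section Interaction

variable {X Ω : Type*} [MeasurableSpace Ω] {n : ℕ}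

/-- Whether the next step releases a response. -/
def Answers (n : ℕ) (sigma : ℕ → ℝ) (ρ : ℝ) (A : Analyst X Ω) (ω : Ω) (s : State X) : Prop :=
  s.terminated = false ∧ s.round ≤ n ∧ A.finished s.round s.size (ω, s.transcript) = false ∧
    s.spent + cost sigma s.round ≤ ρ

/-- The successor of a state in which a response is released with standardized noise `y`. -/
def respond (sigma : ℕ → ℝ) (A : Analyst X Ω) (x : Fin n → X) (ω : Ω) (y : ℝ) (s : State X) :
    State X :=
  let q := A.query s.round s.size (ω, s.transcript)
  { size := s.size + 1
    transcript := Fin.snoc (α := fun _ => Entry X) s.transcript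
      (s.round, q, clamp (prefixValue s.round q x + sigma s.round * y))
    round := s.round
    spent := s.spent + cost sigma s.round
    terminated := false }

variable {sigma : ℕ → ℝ} {ρ : ℝ} {A : Analyst X Ω} {x : Fin n → X} {ω : Ω} {z z' : ℕ → ℝ}
  {s : State X}

theorem step_of_answers (h : Answers n sigma ρ A ω s) (x : Fin n → X) (z : ℕ → ℝ) :
    step sigma ρ A x ω z s = respond sigma A x ω (z s.size) s := by
  obtain ⟨hterminated, hround, hfinished, hcost⟩ := h
  simp only [step, respond, hterminated, hround, hfinished, hcost, snapshotValue_castLE,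
    Bool.false_eq_true, if_false, if_true, dif_pos]

theorem exists_step_eq_of_not_answers (h : ¬ Answers n sigma ρ A ω s) :
    ∃ t b, s.round ≤ t ∧ ∀ (x : Fin n → X) (z : ℕ → ℝ),
      step sigma ρ A x ω z s = { s with round := t, terminated := b } := by
  simp only [Answers, not_and] at h
  unfold step
  split_ifs with hterminated hround hfinished hcost
  · exact ⟨_, _, le_rfl, fun _ _ => rfl⟩
  · exact ⟨_, _, Nat.le_succ _, fun _ _ => rfl⟩
  · exact absurd hcost (h (by simpa using hterminated) hround (by simpa using hfinished))
  · exact ⟨_, _, le_rfl, fun _ _ => rfl⟩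
  · exact ⟨_, _, le_rfl, fun _ _ => rfl⟩

theorem size_le_size_step : s.size ≤ (step sigma ρ A x ω z s).size := by
  by_cases h : Answers n sigma ρ A ω s
  · rw [step_of_answers h]
    exact Nat.le_succ _
  · obtain ⟨t, b, -, hstep⟩ := exists_step_eq_of_not_answers h
    rw [hstep]

theorem step_congr_noise (h : z s.size = z' s.size) :
    step sigma ρ A x ω z s = step sigma ρ A x ω z' s := by
  simp only [step, h]

theorem iterate_step_congr_noise (N : ℕ) (h : ∀ i, s.size ≤ i → z i = z' i) :
    (step sigma ρ A x ω z)^[N] s = (step sigma ρ A x ω z')^[N] s := by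
  induction N generalizing s with
  | zero => rfl
  | succ N ih =>
    rw [Function.iterate_succ_apply, Function.iterate_succ_apply,
      step_congr_noise (h _ le_rfl)]
    exact ih fun i hi => h i (size_le_size_step.trans hi)

theorem measurable_clamp : Measurable clamp :=
  measurable_const.max (measurable_id.min measurable_const)

theorem measurable_prefixValue (t : ℕ) (x : Fin n → X) :
    Measurable fun q : StatQuery X => prefixValue t q x := by
  have hterm (τ : Fin n) : Measurable fun q : StatQuery X =>
      if (τ : ℕ) < t then (q (x τ) : ℝ) else 0 := by
    split_ifs <;> fun_prop
  exact (Finset.measurable_sum Finset.univ fun τ _ => hterm τ).div_const (t : ℝ)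

theorem measurable_snoc {m : ℕ} {Z : Type*} [MeasurableSpace Z] :
    Measurable fun p : (Fin m → Z) × Z => (Fin.snoc p.1 p.2 : Fin (m + 1) → Z) := by
  refine measurable_pi_lambda _ fun i => ?_
  induction i using Fin.lastCases with
  | last => simpa only [Fin.snoc_last] using measurable_snd
  | cast i => simpa only [Fin.snoc_castSucc] using measurable_fst.eval

theorem measurable_step (sigma : ℕ → ℝ) (ρ : ℝ) (A : Analyst X Ω) (x : Fin n → X) :
    Measurable fun p : (Ω × (ℕ → ℝ)) × State X => step sigma ρ A x p.1.1 p.1.2 p.2 := by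
  refine State.measurable_of_fibers fun m t b => ?_
  have hinput : Measurable fun p : (Ω × (ℕ → ℝ)) × (Fin m → Entry X) × ℝ => (p.1.1, p.2.1) := by
    fun_prop
  have hq := (A.measurable_query t m).comp hinput
  have hfinished := (A.measurable_finished t m).comp hinput (measurableSet_singleton true)
  have hcost : MeasurableSet {p : (Ω × (ℕ → ℝ)) × (Fin m → Entry X) × ℝ |
      p.2.2 + cost sigma t ≤ ρ} := measurableSet_le (by fun_prop) measurable_const
  simp only [step, snapshotValue_castLE]
  cases b
  · by_cases ht : t ≤ n
    · simp only [ht, dif_pos, Bool.false_eq_true, if_false]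
      refine .ite hfinished (by fun_prop) (.ite hcost (State.measurable_mk (measurable_snoc.comp
        (.prodMk (by fun_prop) (measurable_const.prodMk (hq.prodMk (measurable_clamp.comp
          (((measurable_prefixValue t x).comp hq).add (by fun_prop))))))) (by fun_prop))
        (by fun_prop))
    · simp only [ht, dif_neg, not_false_eq_true, Bool.false_eq_true, if_false]
      fun_prop
  · simp only [if_true]
    fun_prop

theorem measurable_iterate_step (sigma : ℕ → ℝ) (ρ : ℝ) (A : Analyst X Ω) (x : Fin n → X) (N : ℕ) :
    Measurable fun p : (Ω × (ℕ → ℝ)) × State X => (step sigma ρ A x p.1.1 p.1.2)^[N] p.2 := by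
  induction N with
  | zero => exact measurable_snd
  | succ N ih => exact ih.comp (measurable_fst.prodMk (measurable_step sigma ρ A x))

end Interaction

section Privacy

variable {X Ω : Type*} [MeasurableSpace Ω] {n : ℕ}

/-- The law of the standardized noise of the mechanism. -/
abbrev noise : Measure (ℕ → ℝ) := Measure.infinitePi fun _ => gaussianReal 0 1

/-- The expectation, over the noise, of the value of `f` at the state `N` steps after `s`. -/
def expectedAfter (sigma : ℕ → ℝ) (ρ : ℝ) (A : Analyst X Ω) (x : Fin n → X) (ω : Ω)
    (f : State X → ℝ≥0∞) (N : ℕ) (s : State X) : ℝ≥0∞ :=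
  ∫⁻ z, f ((step sigma ρ A x ω z)^[N] s) ∂noise

variable {sigma : ℕ → ℝ} {ρ : ℝ} {A : Analyst X Ω} {x : Fin n → X} {ω : Ω}
  {f : State X → ℝ≥0∞} {s : State X}

theorem measurable_expectedAfter (hf : Measurable f) (N : ℕ) :
    Measurable (expectedAfter sigma ρ A x ω f N) := by
  have hiterate := measurable_iterate_step sigma ρ A x N
  exact Measurable.lintegral_prod_right' (f := fun p : State X × (ℕ → ℝ) =>
    f ((step sigma ρ A x ω p.2)^[N] p.1)) (hf.comp (hiterate.comp (by fun_prop :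
      Measurable fun p : State X × (ℕ → ℝ) => ((ω, p.2), p.1))))

theorem measurable_respond (h : Answers n sigma ρ A ω s) :
    Measurable fun y => respond sigma A x ω y s := by
  have hrespond : (fun y => respond sigma A x ω y s) = fun y => step sigma ρ A x ω (fun _ => y) s :=
    funext fun y => (step_of_answers h x fun _ => y).symm
  rw [hrespond]
  exact (measurable_step sigma ρ A x).comp (by fun_prop :
    Measurable fun y : ℝ => ((ω, fun _ => y), s))

theorem expectedAfter_succ_of_not_answers (h : ¬ Answers n sigma ρ A ω s) :
    ∃ s' : State X, s'.spent = s.spent ∧ ∀ (x : Fin n → X) (N : ℕ),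
      expectedAfter sigma ρ A x ω f (N + 1) s = expectedAfter sigma ρ A x ω f N s' := by
  obtain ⟨t, b, -, hstep⟩ := exists_step_eq_of_not_answers h
  refine ⟨{ s with round := t, terminated := b }, rfl, fun x N => ?_⟩
  simp only [expectedAfter, Function.iterate_succ_apply, hstep]

/- The step consumes the noise with index `s.size` and the later ones do not, so that this
coordinate can be resampled independently. -/
theorem expectedAfter_succ_of_answers (hf : Measurable f) (N : ℕ) (h : Answers n sigma ρ A ω s) :
    expectedAfter sigma ρ A x ω f (N + 1) s
      = ∫⁻ y, expectedAfter sigma ρ A x ω f N (respond sigma A x ω y s) ∂gaussianReal 0 1 := by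
  have hmeasurable : Measurable fun z => f ((step sigma ρ A x ω z)^[N + 1] s) :=
    hf.comp ((measurable_iterate_step sigma ρ A x (N + 1)).comp (by fun_prop :
      Measurable fun z : ℕ → ℝ => ((ω, z), s)))
  have hupdate (z : ℕ → ℝ) (y : ℝ) :
      (step sigma ρ A x ω (Function.update z s.size y))^[N + 1] s
        = (step sigma ρ A x ω z)^[N] (respond sigma A x ω y s) := by
    rw [Function.iterate_succ_apply, step_of_answers h, Function.update_self]
    exact iterate_step_congr_noise N fun i hi =>
      Function.update_of_ne (Nat.lt_of_succ_le hi).ne' _ _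
  have hswap := lintegral_lintegral_swap (μ := noise) (ν := gaussianReal 0 1) (f := fun z y =>
    f ((step sigma ρ A x ω (Function.update z s.size y))^[N + 1] s))
    (hmeasurable.comp measurable_update').aemeasurable
  rw [expectedAfter, lintegral_infinitePi_eq_lintegral_update _ s.size hmeasurable, hswap]
  simp only [hupdate, expectedAfter]

theorem abs_prefixValue_update_sub_le (t : ℕ) (q : StatQuery X) (x : Fin n → X) (i : Fin n)
    (v : X) : |prefixValue t q x - prefixValue t q (Function.update x i v)| ≤ 1 / t := by
  rw [prefixValue, prefixValue, ← sub_div, ← Finset.sum_sub_distrib, abs_div, Nat.abs_cast]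
  gcongr
  rw [Finset.sum_eq_single i (fun j _ hj => by rw [Function.update_of_ne hj, sub_self]) (by simp)]
  split_ifs
  · exact (abs_sub_le_of_le_of_le (q _).2.1 (q _).2.2 (q _).2.1 (q _).2.2).trans_eq (sub_zero 1)
  · simp

theorem sq_div_two_le_cost {v : ℝ} {t : ℕ} (hσ : 0 < sigma t) (hv : |v| ≤ 1 / t) :
    (v / sigma t) ^ 2 / 2 ≤ cost sigma t := by
  have hsq : (v / sigma t) ^ 2 ≤ (1 / t / sigma t) ^ 2 := by
    rw [sq_le_sq, abs_div, abs_div, abs_of_pos hσ, abs_of_nonneg (by positivity : 0 ≤ 1 / (t : ℝ))]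
    gcongr
  calc (v / sigma t) ^ 2 / 2 ≤ (1 / t / sigma t) ^ 2 / 2 := by gcongr
    _ = cost sigma t := by rw [cost]; field_simp

theorem renyiDominated_expectedAfter_update (hσ : ∀ t, 0 < sigma t) {γ : ℝ} (hγ : 1 < γ) (ε : ℝ)
    (hf : Measurable f) (hf1 : ∀ s, f s ≤ 1) (i : Fin n) (v : X) (N : ℕ) (hs : s.spent ≤ ρ) :
    RenyiDominated γ ε (ρ - s.spent) (expectedAfter sigma ρ A x ω f N s)
      (expectedAfter sigma ρ A (Function.update x i v) ω f N s) := by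
  induction N generalizing s with
  | zero =>
    simpa [expectedAfter] using RenyiDominated.refl hγ (sub_nonneg.2 hs) (hf1 s)
  | succ N ih =>
    by_cases h : Answers n sigma ρ A ω s
    · set x' := Function.update x i v
      set q := A.query s.round s.size (ω, s.transcript) with hq
      set c := (prefixValue s.round q x - prefixValue s.round q x') / sigma s.round with hc
      have hshift (y : ℝ) : respond sigma A x ω y s = respond sigma A x' ω (y + c) s := by
        have hvalue : prefixValue s.round q x + sigma s.round * y
            = prefixValue s.round q x' + sigma s.round * (y + c) := by
          rw [hc]
          field_simp [(hσ s.round).ne']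
          ring
        simp only [respond, ← hq, hvalue]
      have hcost : c ^ 2 / 2 ≤ cost sigma s.round :=
        sq_div_two_le_cost (hσ _) (abs_prefixValue_update_sub_le s.round q x i v)
      have hdominated (y : ℝ) : RenyiDominated γ ε (ρ - (s.spent + cost sigma s.round))
          (expectedAfter sigma ρ A x ω f N (respond sigma A x' ω y s))
          (expectedAfter sigma ρ A x' ω f N (respond sigma A x' ω y s)) :=
        ih h.2.2.2
      rw [expectedAfter_succ_of_answers hf N h, expectedAfter_succ_of_answers hf N h]
      simp only [hshift]
      exact (RenyiDominated.lintegral_gaussianReal c hγ ((measurable_expectedAfter hf N).comp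
        (measurable_respond h)) hdominated).mono_budget hγ (by linarith)
    · obtain ⟨s', hspent, hsucc⟩ := expectedAfter_succ_of_not_answers (f := f) h
      rw [hsucc, hsucc, ← hspent]
      exact ih (hspent.trans_le hs)

variable [MeasurableSpace X] [Countable X] [MeasurableSingletonClass X]

theorem measurable_stateAfter (n₀ : ℕ) (sigma : ℕ → ℝ) (ρ : ℝ) (A : Analyst X Ω) (N : ℕ) :
    Measurable fun p : (Fin n → X) × Ω × (ℕ → ℝ) =>
      stateAfter n₀ sigma ρ A p.1 p.2.1 p.2.2 N :=
  measurable_from_prod_countable_right fun x =>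
    (measurable_iterate_step sigma ρ A x N).comp (measurable_id.prodMk measurable_const)

theorem isDifferentiallyPrivate_stateAfter (hσ : ∀ t, 0 < sigma t) (hρ : 0 ≤ ρ) (ε : ℝ) (n₀ N : ℕ)
    (A : Analyst X Ω) (μ : Measure Ω) [IsProbabilityMeasure μ] :
    IsDifferentiallyPrivate (μ.prod noise)
      (fun (x : Fin n → X) p => stateAfter n₀ sigma ρ A x p.1 p.2 N) ε (deltaOf ρ ε) := by
  intro x i v D hD
  have hlaw (y : Fin n → X) : (μ.prod noise) {p | stateAfter n₀ sigma ρ A y p.1 p.2 N ∈ D}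
      = ∫⁻ ω, expectedAfter sigma ρ A y ω (D.indicator 1) N (initState X n₀) ∂μ := by
    have hM : Measurable fun p : Ω × (ℕ → ℝ) => stateAfter n₀ sigma ρ A y p.1 p.2 N :=
      (measurable_stateAfter n₀ sigma ρ A N).comp measurable_prodMk_left
    have hMD : MeasurableSet {p : Ω × (ℕ → ℝ) | stateAfter n₀ sigma ρ A y p.1 p.2 N ∈ D} := hM hD
    rw [← lintegral_indicator_one hMD,
      lintegral_prod _ (measurable_one.indicator hMD).aemeasurable]
    rfl
  have hind : Measurable (D.indicator (1 : State X → ℝ≥0∞)) := measurable_one.indicator hD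
  have hind1 (s : State X) : D.indicator (1 : State X → ℝ≥0∞) s ≤ 1 :=
    Set.indicator_le_self' (fun _ _ => zero_le) s
  have hprivate (ω : Ω) := RenyiDominated.le_add_deltaOf (ε := ε) fun γ hγ =>
    (renyiDominated_expectedAfter_update (A := A) (x := x) (ω := ω) hσ hγ ε hind hind1 i v N
      (s := initState X n₀) hρ).mono_budget hγ (sub_zero ρ).le
  rw [hlaw, hlaw]
  calc _ ≤ ∫⁻ ω, (ENNReal.ofReal (Real.exp ε) *
        expectedAfter sigma ρ A (Function.update x i v) ω (D.indicator 1) N (initState X n₀)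
          + ENNReal.ofReal (deltaOf ρ ε)) ∂μ := lintegral_mono hprivate
    _ = _ := by
      rw [lintegral_add_right _ measurable_const, lintegral_const_mul' _ _ ENNReal.ofReal_ne_top,
        lintegral_const, measure_univ, mul_one]

end Privacy

section Inaccuracy

theorem clamp_mem_unitInterval (r : ℝ) : clamp r ∈ unitInterval :=
  ⟨le_max_left _ _, max_le zero_le_one (min_le_right _ _)⟩

theorem abs_clamp_add_sub_le {v : ℝ} (hv : v ∈ unitInterval) (y : ℝ) :
    |clamp (v + y) - v| ≤ |y| := by
  have hclamp : clamp v = v := by rw [clamp, min_eq_left hv.2, max_eq_right hv.1]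
  calc |clamp (v + y) - v| = |max 0 (min (v + y) 1) - max 0 (min v 1)| := by
        rw [← clamp, ← clamp, hclamp]
    _ ≤ |min (v + y) 1 - min v 1| := by
        simpa using abs_max_sub_max_le_max 0 (min (v + y) 1) 0 (min v 1)
    _ ≤ |v + y - v| := by simpa using abs_min_sub_min_le_max (v + y) 1 v 1
    _ = |y| := by rw [add_sub_cancel_left]

variable {X : Type*} {n n₀ k t : ℕ} {α α₁ : ℝ} {s : State X}

theorem prefixValue_mem_unitInterval (ht₀ : 1 ≤ t) (ht : t ≤ n) (q : StatQuery X) (x : Fin n → X) :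
    prefixValue t q x ∈ unitInterval :=
  ⟨prefixValue_nonneg q x,
    sub_nonneg.1 ((prefixValue_nonneg _ x).trans_eq (prefixValue_symm ht₀ ht q x))⟩

variable [MeasurableSpace X] (P : Measure X)

/-- Whether the answer with index `i` is among the first `k`, belongs to a round from `n₀` to `n`,
and is further than `α` from the mean of its query. -/
def IsInaccurate (n₀ n k : ℕ) (α : ℝ) (s : State X) (i : ℕ) : Prop :=
  i < k ∧ i < s.size ∧ n₀ ≤ (s.entry i).1 ∧ (s.entry i).1 ≤ n ∧
    α < |(s.entry i).2.2 - queryMean P (s.entry i).2.1|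

open Classical in
/-- The transcript entry that the analysis selects: the last inaccurate one among the first `k`. -/
def selectedEntry (n₀ n k : ℕ) (α : ℝ) (s : State X) : Entry X :=
  s.entry (Nat.findGreatest (IsInaccurate P n₀ n k α s) k)

open Classical in
/-- The query of a transcript entry, or its complement `1 - q` if the response does not exceed the
mean of `q`. This turns every inaccurate response into an overestimate. -/
def overestimatedQuery (e : Entry X) : StatQuery X :=
  if queryMean P e.2.1 < e.2.2 then e.2.1 else fun v => unitInterval.symm (e.2.1 v)

variable {P}

theorem exists_isInaccurate_and_selectedEntry_eq (h : ∃ i, IsInaccurate P n₀ n k α s i) :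
    ∃ i, IsInaccurate P n₀ n k α s i ∧ selectedEntry P n₀ n k α s = s.entry i := by
  classical
  obtain ⟨i, hi⟩ := h
  exact ⟨_, Nat.findGreatest_spec hi.1.le hi, rfl⟩

variable [IsProbabilityMeasure P] {e : Entry X}

theorem add_queryMean_overestimatedQuery_le_one (hq : Measurable e.2.1) (hr : e.2.2 ∈ unitInterval)
    (hα : α < |e.2.2 - queryMean P e.2.1|) : α + queryMean P (overestimatedQuery P e) ≤ 1 := by
  obtain ⟨hr₀, hr₁⟩ := hr
  rw [lt_abs] at hα
  unfold overestimatedQuery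
  split_ifs with hlt
  · rcases hα with hα | hα <;> linarith
  · rw [queryMean_symm P hq]
    rcases hα with hα | hα <;> linarith

theorem add_queryMean_overestimatedQuery_le {x : Fin n → X} (hq : Measurable e.2.1)
    (ht₀ : 1 ≤ e.1) (ht : e.1 ≤ n) (hα : α < |e.2.2 - queryMean P e.2.1|)
    (hα₁ : |e.2.2 - prefixValue e.1 e.2.1 x| ≤ α₁) :
    α - α₁ + queryMean P (overestimatedQuery P e)
      ≤ prefixValue e.1 (overestimatedQuery P e) x := by
  obtain ⟨hlower, hupper⟩ := abs_le.1 hα₁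
  rw [lt_abs] at hα
  unfold overestimatedQuery
  split_ifs with hlt
  · rcases hα with hα | hα <;> linarith
  · rw [queryMean_symm P hq, prefixValue_symm ht₀ ht]
    rcases hα with hα | hα <;> linarith

end Inaccuracy

section Measurability

variable {X : Type*} [MeasurableSpace X] [Countable X] [MeasurableSingletonClass X]
  (P : Measure X) [SFinite P] {n₀ n k : ℕ} {α : ℝ}

@[fun_prop] theorem measurable_queryMean : Measurable (queryMean P) := by
  have heval : Measurable fun p : StatQuery X × X => (p.1 p.2 : ℝ) :=
    measurable_from_prod_countable_left fun v => by fun_prop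
  exact heval.stronglyMeasurable.integral_prod_right'.measurable

theorem measurableSet_isInaccurate (n₀ n k : ℕ) (α : ℝ) (i : ℕ) :
    MeasurableSet {s : State X | IsInaccurate P n₀ n k α s i} := by
  have hentry : Measurable fun s : State X => s.entry i := State.measurable_entry.eval
  have hround : Measurable fun s : State X => (s.entry i).1 := hentry.fst
  have herror : Measurable fun s : State X =>
      |(s.entry i).2.2 - queryMean P (s.entry i).2.1| := by fun_prop
  exact (MeasurableSet.const _).inter
    ((measurableSet_lt measurable_const State.measurable_size).inter
      ((measurableSet_le measurable_const hround).inter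
        ((measurableSet_le hround measurable_const).inter
          (measurableSet_lt measurable_const herror))))

theorem measurable_selectedEntry : Measurable (selectedEntry P n₀ n k α) := by
  classical
  have hindex : Measurable fun s : State X => Nat.findGreatest (IsInaccurate P n₀ n k α s) k :=
    measurable_findGreatest fun i _ => measurableSet_isInaccurate P n₀ n k α i
  have heval : Measurable fun p : (ℕ → Entry X) × ℕ => p.1 p.2 :=
    measurable_from_prod_countable_left fun i => measurable_pi_apply i
  exact heval.comp (State.measurable_entry.prodMk hindex)

theorem measurable_overestimatedQuery : Measurable (overestimatedQuery P) := by
  have hsymm : Measurable unitInterval.symm := unitInterval.continuous_symm.measurable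
  have hover : MeasurableSet {e : Entry X | queryMean P e.2.1 < e.2.2} :=
    measurableSet_lt (by fun_prop) (by fun_prop)
  refine Measurable.ite hover (by fun_prop) ?_
  exact measurable_pi_lambda _ fun v => hsymm.comp (by fun_prop)

end Measurability

section Trajectories

variable {X Ω : Type*} [MeasurableSpace Ω] {n n₀ k : ℕ} {sigma : ℕ → ℝ} {ρ : ℝ}
  {A : Analyst X Ω} {x : Fin n → X} {ω : Ω} {z : ℕ → ℝ} {s : State X}

/-- The invariant that ties the transcript of a state to the dataset `x` and the noise `z`: the
rounds lie between `n₀` and `n`, and each response is the clamped noisy value of its query. -/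
def State.IsConsistent (n₀ : ℕ) (sigma : ℕ → ℝ) (x : Fin n → X) (z : ℕ → ℝ) (s : State X) : Prop :=
  n₀ ≤ s.round ∧ ∀ i : Fin s.size, n₀ ≤ (s.transcript i).1 ∧ (s.transcript i).1 ≤ n ∧
    (s.transcript i).2.2 = clamp (prefixValue (s.transcript i).1 (s.transcript i).2.1 x
      + sigma (s.transcript i).1 * z i)

theorem State.IsConsistent.step (h : s.IsConsistent n₀ sigma x z) (ρ : ℝ) (A : Analyst X Ω)
    (ω : Ω) : (step sigma ρ A x ω z s).IsConsistent n₀ sigma x z := by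
  by_cases ha : Answers n sigma ρ A ω s
  · rw [step_of_answers ha]
    refine ⟨h.1, fun i => ?_⟩
    induction i using Fin.lastCases with
    | last => simpa only [respond, Fin.snoc_last] using ⟨h.1, ha.2.1, rfl⟩
    | cast i =>
      simpa only [respond, Fin.snoc_castSucc, Fin.val_castSucc] using h.2 i
  · obtain ⟨t, b, hround, hstep⟩ := exists_step_eq_of_not_answers ha
    rw [hstep]
    exact ⟨h.1.trans hround, h.2⟩

theorem stateAfter_succ (N : ℕ) : stateAfter n₀ sigma ρ A x ω z (N + 1)
    = step sigma ρ A x ω z (stateAfter n₀ sigma ρ A x ω z N) :=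
  Function.iterate_succ_apply' _ _ _

theorem isConsistent_stateAfter (N : ℕ) :
    (stateAfter n₀ sigma ρ A x ω z N).IsConsistent n₀ sigma x z := by
  induction N with
  | zero => exact ⟨le_rfl, fun i => i.elim0⟩
  | succ N ih =>
    rw [stateAfter_succ]
    exact ih.step ρ A ω

theorem entry_step {i : ℕ} (hi : i < s.size) : (step sigma ρ A x ω z s).entry i = s.entry i := by
  by_cases ha : Answers n sigma ρ A ω s
  · have hi' : i < (respond sigma A x ω (z s.size) s).size := hi.trans (Nat.lt_succ_self _)
    rw [step_of_answers ha, State.entry, State.entry, dif_pos hi, dif_pos hi']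
    exact Fin.snoc_castSucc (α := fun _ => Entry X) _ _ ⟨i, hi⟩
  · obtain ⟨t, b, -, hstep⟩ := exists_step_eq_of_not_answers ha
    rw [hstep]
    rfl

variable [MeasurableSpace X] {P : Measure X} {α : ℝ}

theorem IsInaccurate.step {i : ℕ} (h : IsInaccurate P n₀ n k α s i) :
    IsInaccurate P n₀ n k α (step sigma ρ A x ω z s) i := by
  obtain ⟨hk, hi, h⟩ := h
  refine ⟨hk, hi.trans_le size_le_size_step, ?_⟩
  rwa [entry_step hi]

/-- The event that one of the first `k` standardized noise values exceeds `√2 u` in size. -/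
def largeNoise (X Ω : Type*) (n k : ℕ) (u : ℝ) : Set ((Fin n → X) × Ω × (ℕ → ℝ)) :=
  {w | ∃ i < k, √2 * u < |w.2.2 i|}

theorem measurableSet_largeNoise (k : ℕ) (u : ℝ) : MeasurableSet (largeNoise X Ω n k u) := by
  have hset : largeNoise X Ω n k u = ⋃ i ∈ Set.Iio k, {w | √2 * u < |w.2.2 i|} := by
    ext w
    simp [largeNoise]
  rw [hset]
  exact .biUnion (Set.to_countable _) fun i _ => measurableSet_lt measurable_const (by fun_prop)

instance [IsProbabilityMeasure P] (μ : Measure Ω) [IsProbabilityMeasure μ] :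
    IsProbabilityMeasure (jointLaw n P μ) := by
  unfold jointLaw
  infer_instance

theorem measureReal_largeNoise_le (P : Measure X) [IsProbabilityMeasure P] (μ : Measure Ω)
    [IsProbabilityMeasure μ] (hk : 1 ≤ k) {β : ℝ} (h₀ : 0 < β) (h₁ : β < 1) :
    (jointLaw n P μ).real (largeNoise X Ω n k (erfcInv (β / k))) ≤ β := by
  set u := erfcInv (β / k)
  have hk₀ : (0 : ℝ) < k := mod_cast hk
  have hβk : β / k ≤ 1 := div_le_one_of_le₀ (h₁.le.trans (mod_cast hk)) hk₀.le
  have hcoordinate (i : ℕ) : jointLaw n P μ {w | √2 * u < |w.2.2 i|}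
      ≤ ENNReal.ofReal (β / k) := by
    have hpreserving : MeasurePreserving (fun w : (Fin n → X) × Ω × (ℕ → ℝ) => w.2.2 i)
        (jointLaw n P μ) (gaussianReal 0 1) :=
      (measurePreserving_eval_infinitePi (fun _ : ℕ => gaussianReal 0 1) i).comp
        (measurePreserving_snd.comp measurePreserving_snd)
    have htail : MeasurableSet {y : ℝ | √2 * u < |y|} :=
      measurableSet_lt measurable_const (by fun_prop)
    rw [← erfc_erfcInv (by positivity) hβk]
    exact (hpreserving.measure_preimage htail.nullMeasurableSet).trans_le
      (gaussianReal_sqrt_two_mul_lt_abs_le u)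
  have hunion : largeNoise X Ω n k u ⊆ ⋃ i ∈ Finset.range k, {w | √2 * u < |w.2.2 i|} :=
    fun w ⟨i, hi, hw⟩ => Set.mem_biUnion (Finset.mem_coe.2 (Finset.mem_range.2 hi)) hw
  refine ENNReal.toReal_le_of_le_ofReal h₀.le ?_
  calc jointLaw n P μ (largeNoise X Ω n k u)
      ≤ ∑ i ∈ Finset.range k, jointLaw n P μ {w | √2 * u < |w.2.2 i|} :=
        (measure_mono hunion).trans (measure_biUnion_finset_le _ _)
    _ ≤ ∑ _i ∈ Finset.range k, ENNReal.ofReal (β / k) := Finset.sum_le_sum fun i _ => hcoordinate i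
    _ = ENNReal.ofReal β := by
        rw [Finset.sum_const, Finset.card_range, nsmul_eq_mul, ← ENNReal.ofReal_natCast,
          ← ENNReal.ofReal_mul hk₀.le, mul_div_cancel₀ _ hk₀.ne']

end Trajectories

section Accuracy

theorem mul_measureReal_le_of_setIntegral_le {W : Type*} [MeasurableSpace W] {J : Measure W}
    [IsFiniteMeasure J] {E B : Set W} {p m : W → ℝ} {c ε δ : ℝ} (hE : MeasurableSet E)
    (hB : MeasurableSet B) (hp : IntegrableOn p E J) (hm : IntegrableOn m E J)
    (hm₁ : ∀ w ∈ E, m w ≤ 1) (hε : 0 ≤ ε) (hpm : ∀ w ∈ E, c + m w ≤ p w + B.indicator 1 w)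
    (hle : ∫ w in E, p w ∂J ≤ Real.exp ε * ∫ w in E, m w ∂J + δ) :
    (c - (Real.exp ε - 1)) * J.real E ≤ δ + J.real B := by
  have hconst (r : ℝ) : IntegrableOn (fun _ => r) E J := integrable_const r
  have hind : IntegrableOn (B.indicator (1 : W → ℝ)) E J := (integrable_const 1).indicator hB
  have hsum := setIntegral_mono_on ((hconst c).add hm) (hp.add hind) hE hpm
  have hmean := setIntegral_mono_on hm (hconst 1) hE hm₁
  have hBE : (J.restrict E).real B ≤ J.real B := by
    rw [measureReal_restrict_apply hB]
    exact measureReal_mono Set.inter_subset_left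
  simp only [Pi.add_apply] at hsum
  rw [integral_add (hconst c) hm, integral_add hp hind, integral_indicator_one hB,
    setIntegral_const, smul_eq_mul] at hsum
  rw [setIntegral_const, smul_eq_mul, mul_one] at hmean
  have hexp := mul_le_mul_of_nonneg_left hmean (sub_nonneg.2 (Real.one_le_exp hε))
  linarith

theorem IsDifferentiallyPrivate.mul_measureReal_le {X S Ψ : Type*} [MeasurableSpace X]
    [MeasurableSpace S] [MeasurableSpace Ψ] {n n₀ : ℕ} {D : Set S} {T : S → ℕ} {Q : S → StatQuery X}
    {ν : Measure Ψ} [IsProbabilityMeasure ν] {M : (Fin n → X) → Ψ → S} {ε δ c : ℝ}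
    {B : Set ((Fin n → X) × Ψ)} (h : IsDifferentiallyPrivate ν M ε δ) (hε : 0 ≤ ε) (hδ : 0 ≤ δ)
    (hM : Measurable (Function.uncurry M)) (P : Measure X) [IsProbabilityMeasure P]
    (hD : MeasurableSet D) (hT : Measurable T) (hQ : Measurable fun p : S × X => Q p.1 p.2)
    (hn₀ : 1 ≤ n₀) (hlow : ∀ s ∈ D, n₀ ≤ T s) (hup : ∀ s ∈ D, T s ≤ n) (hB : MeasurableSet B)
    (hexcess : ∀ w, M w.1 w.2 ∈ D → c + queryMean P (Q (M w.1 w.2))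
      ≤ prefixValue (T (M w.1 w.2)) (Q (M w.1 w.2)) w.1 + B.indicator 1 w) :
    (c - (Real.exp ε - 1)) * ((Measure.pi fun _ => P).prod ν).real {w | M w.1 w.2 ∈ D}
      ≤ n * δ / n₀ + ((Measure.pi fun _ => P).prod ν).real B := by
  have hMm : Measurable fun w : (Fin n → X) × Ψ => M w.1 w.2 := hM
  have hTm : Measurable fun w : (Fin n → X) × Ψ => T (M w.1 w.2) := hT.comp hM
  have hmean : Measurable fun w : (Fin n → X) × Ψ => queryMean P (Q (M w.1 w.2)) :=
    (StronglyMeasurable.integral_prod_right' (f := fun p : S × X => (Q p.1 p.2 : ℝ))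
      (by fun_prop)).measurable.comp hM
  have hterm (τ : Fin n) : Measurable fun w : (Fin n → X) × Ψ =>
      if (τ : ℕ) < T (M w.1 w.2) then (Q (M w.1 w.2) (w.1 τ) : ℝ) else 0 :=
    .ite (measurableSet_lt measurable_const hTm) (by fun_prop) measurable_const
  have hvalue : Measurable fun w : (Fin n → X) × Ψ =>
      prefixValue (T (M w.1 w.2)) (Q (M w.1 w.2)) w.1 :=
    (Finset.measurable_sum Finset.univ fun τ _ => hterm τ).div (by fun_prop)
  have hvalueUnit : ∀ w ∈ {w : (Fin n → X) × Ψ | M w.1 w.2 ∈ D},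
      prefixValue (T (M w.1 w.2)) (Q (M w.1 w.2)) w.1 ∈ unitInterval := fun w hw =>
    prefixValue_mem_unitInterval (hn₀.trans (hlow _ hw)) (hup _ hw) _ _
  exact mul_measureReal_le_of_setIntegral_le (hM hD) hB
    (.of_mem_Icc 0 1 hvalue.aemeasurable (ae_restrict_of_forall_mem (hM hD) hvalueUnit))
    (.of_mem_Icc 0 1 hmean.aemeasurable (.of_forall fun w => queryMean_mem_unitInterval P _))
    (fun w _ => (queryMean_mem_unitInterval P _).2) hε hexcess
    (h.setIntegral_prefixValue_le hδ hM P hD hT hQ hn₀ hlow hup)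

variable {X Ω : Type*} [MeasurableSpace X] {P : Measure X} {n n₀ k : ℕ} {sigma : ℕ → ℝ} {ρ α : ℝ}

theorem State.IsConsistent.add_queryMean_le [DiscreteMeasurableSpace X] [IsProbabilityMeasure P]
    {s : State X} {w : (Fin n → X) × Ω × (ℕ → ℝ)} (h : s.IsConsistent n₀ sigma w.1 w.2.2)
    (hn₀ : 1 ≤ n₀) {σ u : ℝ} (hσ : ∀ t, 0 < sigma t ∧ sigma t ≤ σ) (hu : 0 ≤ u)
    (hs : ∃ i, IsInaccurate P n₀ n k α s i) :
    α - √2 * σ * u + queryMean P (overestimatedQuery P (selectedEntry P n₀ n k α s))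
      ≤ prefixValue (selectedEntry P n₀ n k α s).1
          (overestimatedQuery P (selectedEntry P n₀ n k α s)) w.1
        + (largeNoise X Ω n k u).indicator 1 w := by
  obtain ⟨i, ⟨hik, hi, hlow, hup, hα⟩, hselected⟩ := exists_isInaccurate_and_selectedEntry_eq hs
  rw [hselected]
  obtain ⟨-, -, hr⟩ := h.2 ⟨i, hi⟩
  rw [← s.entry_val] at hr
  have hσ₀ : 0 < σ := (hσ 0).1.trans_le (hσ 0).2
  have hq : Measurable (s.entry i).2.1 := .of_discrete
  by_cases hw : w ∈ largeNoise X Ω n k u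
  · have hone := add_queryMean_overestimatedQuery_le_one (P := P) hq
      (hr ▸ clamp_mem_unitInterval _) hα
    have hvalue := prefixValue_nonneg (t := (s.entry i).1) (overestimatedQuery P (s.entry i)) w.1
    rw [Set.indicator_of_mem hw, Pi.one_apply]
    linarith [show 0 ≤ √2 * σ * u by positivity]
  · have hz : |w.2.2 i| ≤ √2 * u := not_lt.1 fun hlt => hw ⟨i, hik, hlt⟩
    rw [Set.indicator_of_notMem hw, add_zero]
    refine add_queryMean_overestimatedQuery_le hq (hn₀.trans hlow) hup hα ?_
    rw [hr]
    refine (abs_clamp_add_sub_le (prefixValue_mem_unitInterval (hn₀.trans hlow) hup _ _) _).trans ?_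
    rw [abs_mul, abs_of_pos (hσ _).1, mul_comm √2 σ, mul_assoc]
    exact mul_le_mul (hσ _).2 hz (abs_nonneg _) hσ₀.le

variable [Countable X] [MeasurableSingletonClass X] [MeasurableSpace Ω] {σ β ε : ℝ}

theorem mul_measureReal_exists_isInaccurate_le (hn₀ : 1 ≤ n₀) (hk : 1 ≤ k)
    (hσ : ∀ t, 0 < sigma t ∧ sigma t ≤ σ) (hρ : 0 ≤ ρ) (P : Measure X) [IsProbabilityMeasure P]
    (μ : Measure Ω) [IsProbabilityMeasure μ] (A : Analyst X Ω) (h₀ : 0 < β) (h₁ : β < 1)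
    (hε : 0 ≤ ε) (α : ℝ) (N : ℕ) :
    (α - √2 * σ * erfcInv (β / k) - (Real.exp ε - 1)) * (jointLaw n P μ).real
        {w | ∃ i, IsInaccurate P n₀ n k α (stateAfter n₀ sigma ρ A w.1 w.2.1 w.2.2 N) i}
      ≤ n * deltaOf ρ ε / n₀ + β := by
  set M : (Fin n → X) → Ω × (ℕ → ℝ) → State X := fun x p => stateAfter n₀ sigma ρ A x p.1 p.2 N
  set D : Set (State X) := {s | ∃ i, IsInaccurate P n₀ n k α s i} with hDdef
  have hD : MeasurableSet D := by
    rw [hDdef, Set.ofPred_exists]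
    exact .iUnion (measurableSet_isInaccurate P n₀ n k α)
  have he : Measurable (selectedEntry P n₀ n k α) := measurable_selectedEntry P
  have hq : Measurable fun p : State X × X =>
      overestimatedQuery P (selectedEntry P n₀ n k α p.1) p.2 :=
    measurable_from_prod_countable_left fun v =>
      ((measurable_overestimatedQuery P).comp he).eval
  have hround : ∀ s ∈ D, n₀ ≤ (selectedEntry P n₀ n k α s).1 ∧
      (selectedEntry P n₀ n k α s).1 ≤ n := fun s hs => by
    obtain ⟨i, hi, hei⟩ := exists_isInaccurate_and_selectedEntry_eq hs
    exact hei ▸ ⟨hi.2.2.1, hi.2.2.2.1⟩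
  have hk₀ : (0 : ℝ) < k := mod_cast hk
  have hu : 0 ≤ erfcInv (β / k) := erfcInv_nonneg (by positivity)
    ((div_lt_one hk₀).2 (h₁.trans_le (mod_cast hk)))
  have hprivate : IsDifferentiallyPrivate (μ.prod noise) M ε (deltaOf ρ ε) :=
    isDifferentiallyPrivate_stateAfter (fun t => (hσ t).1) hρ ε n₀ N A μ
  refine (hprivate.mul_measureReal_le (Q := fun s => overestimatedQuery P
    (selectedEntry P n₀ n k α s)) hε (deltaOf_nonneg ρ ε) (measurable_stateAfter n₀ sigma ρ A N) P
    hD he.fst hq hn₀ (fun s hs => (hround s hs).1) (fun s hs => (hround s hs).2)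
    (measurableSet_largeNoise k (erfcInv (β / k)))
    (fun w hw => (isConsistent_stateAfter N).add_queryMean_le hn₀ hσ hu hw)).trans ?_
  gcongr
  exact measureReal_largeNoise_le P μ hk h₀ h₁

end Accuracy

section Conclusion

/-- The error bound that the argument yields. Compared with `errorBound`, its privacy term lacks
the factor `2` and the square root is absent. -/
def sharpErrorBound (n₀ n k : ℕ) (ρ β' σ β ε : ℝ) : ℝ :=
  √2 * σ * erfcInv (β / k) + Real.exp ε - 1 + n * deltaOf ρ ε / (n₀ * β') + β / β'

/-- The event whose probability `IsDistributionallyAccurate` bounds: one of the first `k` answers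
that are ever released has distributional error more than `α`. -/
def inaccuracyEvent {X Ω : Type*} [MeasurableSpace X] [MeasurableSpace Ω] (P : Measure X)
    (n₀ n k : ℕ) (sigma : ℕ → ℝ) (ρ : ℝ) (A : Analyst X Ω) (α : ℝ) :
    Set ((Fin n → X) × Ω × (ℕ → ℝ)) :=
  {w | ∃ N, ∃ i : Fin (stateAfter n₀ sigma ρ A w.1 w.2.1 w.2.2 N).size, (i : ℕ) < k ∧
    α < |((stateAfter n₀ sigma ρ A w.1 w.2.1 w.2.2 N).transcript i).2.2 -
      populationValue P
        ((stateAfter n₀ sigma ρ A w.1 w.2.1 w.2.2 N).transcript i).1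
        ((stateAfter n₀ sigma ρ A w.1 w.2.1 w.2.2 N).transcript i).2.1|}

section

variable {X : Type u} {Ω : Type v} [MeasurableSpace X] [MeasurableSpace Ω] {n₀ n k : ℕ}
  {sigma : ℕ → ℝ} {ρ β' : ℝ}

theorem inaccuracyEvent_antitone (P : Measure X) (n₀ n k : ℕ) (sigma : ℕ → ℝ) (ρ : ℝ)
    (A : Analyst X Ω) : Antitone (inaccuracyEvent P n₀ n k sigma ρ A) :=
  fun _ _ hab _ ⟨N, i, hi, hlt⟩ => ⟨N, i, hi, hab.trans_lt hlt⟩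

theorem IsDistributionallyAccurate.mono {α α' : ℝ}
    (h : IsDistributionallyAccurate.{u, v} X n₀ n k sigma ρ α β') (hα : α ≤ α') :
    IsDistributionallyAccurate.{u, v} X n₀ n k sigma ρ α' β' := fun P _ Ω _ μ _ A =>
  (measure_mono (inaccuracyEvent_antitone P n₀ n k sigma ρ A hα)).trans (h P Ω μ A)

theorem isDistributionallyAccurate_sInf {s : Set ℝ} (hs : s.Nonempty)
    (h : ∀ α ∈ s, IsDistributionallyAccurate.{u, v} X n₀ n k sigma ρ α β') :
    IsDistributionallyAccurate.{u, v} X n₀ n k sigma ρ (sInf s) β' := by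
  intro P _ Ω _ μ _ A
  set F : ℕ → Set ((Fin n → X) × Ω × (ℕ → ℝ)) := fun m =>
    inaccuracyEvent P n₀ n k sigma ρ A (sInf s + 1 / ((m : ℝ) + 1))
  have hmono : Monotone F := fun a b hab =>
    inaccuracyEvent_antitone P n₀ n k sigma ρ A (by gcongr)
  have hunion : inaccuracyEvent P n₀ n k sigma ρ A (sInf s) ⊆ ⋃ m, F m := by
    rintro w ⟨N, i, hik, hi⟩
    obtain ⟨m, hm⟩ := exists_nat_one_div_lt (sub_pos.2 hi)
    exact Set.mem_iUnion.2 ⟨m, N, i, hik, lt_sub_iff_add_lt'.1 hm⟩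
  have hF (m : ℕ) : jointLaw n P μ (F m) ≤ ENNReal.ofReal β' := by
    obtain ⟨α, hα, hlt⟩ := exists_lt_of_csInf_lt hs
      (lt_add_of_pos_right (sInf s) (Nat.one_div_pos_of_nat (n := m) : 0 < 1 / ((m : ℝ) + 1)))
    exact ((h α hα).mono hlt.le) P Ω μ A
  calc jointLaw n P μ (inaccuracyEvent P n₀ n k sigma ρ A (sInf s))
      ≤ jointLaw n P μ (⋃ m, F m) := measure_mono hunion
    _ = ⨆ m, jointLaw n P μ (F m) := hmono.measure_iUnion
    _ ≤ ENNReal.ofReal β' := iSup_le hF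

variable [Countable X] [MeasurableSingletonClass X] {σ β ε : ℝ}

theorem inaccuracyEvent_subset_iUnion (hn₀ : 1 ≤ n₀) (P : Measure X) [IsProbabilityMeasure P]
    (A : Analyst X Ω) (α : ℝ) : inaccuracyEvent P n₀ n k sigma ρ A α ⊆ ⋃ N,
      {w | ∃ i, IsInaccurate P n₀ n k α (stateAfter n₀ sigma ρ A w.1 w.2.1 w.2.2 N) i} := by
  rintro w ⟨N, i, hik, hα⟩
  obtain ⟨hlow, hup, -⟩ := (isConsistent_stateAfter N).2 i
  rw [populationValue_eq_queryMean P (hn₀.trans hlow) .of_discrete] at hα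
  refine Set.mem_iUnion.2 ⟨N, i, hik, i.2, ?_⟩
  rw [State.entry_val]
  exact ⟨hlow, hup, hα⟩

theorem jointLaw_exists_isInaccurate_sharpErrorBound_le (hn₀ : 1 ≤ n₀) (hk : 1 ≤ k)
    (hσ : ∀ t, 0 < sigma t ∧ sigma t ≤ σ) (hρ : 0 ≤ ρ) (hβ' : 0 < β') (hθ : (σ, β, ε) ∈ paramSet)
    (P : Measure X) [IsProbabilityMeasure P] (μ : Measure Ω) [IsProbabilityMeasure μ]
    (A : Analyst X Ω) (N : ℕ) :
    jointLaw n P μ {w | ∃ i, IsInaccurate P n₀ n k (sharpErrorBound n₀ n k ρ β' σ β ε)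
        (stateAfter n₀ sigma ρ A w.1 w.2.1 w.2.2 N) i} ≤ ENNReal.ofReal β' := by
  obtain ⟨-, h₀, h₁, hε⟩ := hθ
  have hbound := mul_measureReal_exists_isInaccurate_le (n := n) hn₀ hk hσ hρ P μ A h₀ h₁ hε
    (sharpErrorBound n₀ n k ρ β' σ β ε) N
  have hexcess : sharpErrorBound n₀ n k ρ β' σ β ε - √2 * σ * erfcInv (β / k) - (Real.exp ε - 1)
      = (n * deltaOf ρ ε / n₀ + β) / β' := by
    rw [sharpErrorBound]
    field_simp
    ring
  have hpos : 0 < n * deltaOf ρ ε / n₀ + β := by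
    have := deltaOf_nonneg ρ ε
    positivity
  rw [hexcess, div_mul_eq_mul_div, div_le_iff₀ hβ'] at hbound
  rw [← ofReal_measureReal]
  exact ENNReal.ofReal_le_ofReal (le_of_mul_le_mul_left hbound hpos)

theorem isDistributionallyAccurate_sharpErrorBound (hn₀ : 1 ≤ n₀) (hk : 1 ≤ k)
    (hσ : ∀ t, 0 < sigma t ∧ sigma t ≤ σ) (hρ : 0 ≤ ρ) (hβ' : 0 < β')
    (hθ : (σ, β, ε) ∈ paramSet) :
    IsDistributionallyAccurate.{u, v} X n₀ n k sigma ρ (sharpErrorBound n₀ n k ρ β' σ β ε) β' := by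
  intro P _ Ω _ μ _ A
  set α := sharpErrorBound n₀ n k ρ β' σ β ε
  have hmono : Monotone fun N => {w : (Fin n → X) × Ω × (ℕ → ℝ) | ∃ i,
      IsInaccurate P n₀ n k α (stateAfter n₀ sigma ρ A w.1 w.2.1 w.2.2 N) i} :=
    monotone_nat_of_le_succ fun N w ⟨i, hi⟩ => ⟨i, by rw [stateAfter_succ]; exact hi.step⟩
  exact (measure_mono (inaccuracyEvent_subset_iUnion hn₀ P A α)).trans
    (hmono.measure_iUnion.trans_le (iSup_le fun N =>
      jointLaw_exists_isInaccurate_sharpErrorBound_le hn₀ hk hσ hρ hβ' hθ P μ A N))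

end

variable {n₀ n k : ℕ} {ρ β' σ β ε : ℝ}

theorem sharpErrorBound_nonneg (hk : 1 ≤ k) (hβ' : 0 ≤ β') (hθ : (σ, β, ε) ∈ paramSet) :
    0 ≤ sharpErrorBound n₀ n k ρ β' σ β ε := by
  obtain ⟨hσ : 0 < σ, h₀ : 0 < β, h₁ : β < 1, hε : 0 ≤ ε⟩ := hθ
  have hk₀ : (0 : ℝ) < k := mod_cast hk
  have hnoise : 0 ≤ erfcInv (β / k) := erfcInv_nonneg (by positivity)
    ((div_lt_one hk₀).2 (h₁.trans_le (mod_cast hk)))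
  have hδ := deltaOf_nonneg ρ ε
  rw [sharpErrorBound, add_sub_assoc]
  have hexp : 0 ≤ Real.exp ε - 1 := sub_nonneg.2 (Real.one_le_exp hε)
  positivity

theorem sharpErrorBound_le_errorBound (hβ' : 0 ≤ β') :
    sharpErrorBound n₀ n k ρ β' σ β ε ≤ errorBound n₀ n k ρ β' σ β ε := by
  have hδ := deltaOf_nonneg ρ ε
  have hdouble : n * deltaOf ρ ε / (n₀ * β') ≤ 2 * n * deltaOf ρ ε / (n₀ * β') := by
    gcongr
    linarith [n.cast_nonneg (α := ℝ)]
  have hsqrt : 0 ≤ 2 / β' * √(2 * β * n * deltaOf ρ ε / n₀) := by positivity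
  unfold sharpErrorBound errorBound
  linarith

theorem sInf_sharpErrorBound_le_errorBound (hk : 1 ≤ k) (hβ' : 0 ≤ β')
    (hθ : (σ, β, ε) ∈ paramSet) :
    sInf {a | ∃ β ε : ℝ, (σ, β, ε) ∈ paramSet ∧ a = sharpErrorBound n₀ n k ρ β' σ β ε}
      ≤ errorBound n₀ n k ρ β' σ β ε := by
  have hbelow : BddBelow {a | ∃ β ε : ℝ, (σ, β, ε) ∈ paramSet ∧
      a = sharpErrorBound n₀ n k ρ β' σ β ε} := by
    refine ⟨0, ?_⟩
    rintro _ ⟨β, ε, h, rfl⟩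
    exact sharpErrorBound_nonneg hk hβ' h
  exact (csInf_le hbelow ⟨β, ε, hθ, rfl⟩).trans (sharpErrorBound_le_errorBound hβ')

theorem exists_mem_paramSet (hσ : 0 < σ) : ∃ β ε : ℝ, (σ, β, ε) ∈ paramSet :=
  ⟨1 / 2, 0, hσ, by norm_num, by norm_num, le_rfl⟩

theorem sInf_sharpErrorBound_le_sInf_errorBound (hk : 1 ≤ k) (hβ' : 0 ≤ β') (hσ : 0 < σ) :
    sInf {a | ∃ β ε : ℝ, (σ, β, ε) ∈ paramSet ∧ a = sharpErrorBound n₀ n k ρ β' σ β ε}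
      ≤ sInf {a | ∃ β ε : ℝ, (σ, β, ε) ∈ paramSet ∧ a = errorBound n₀ n k ρ β' σ β ε} := by
  obtain ⟨β, ε, hθ⟩ := exists_mem_paramSet hσ
  refine le_csInf ⟨_, β, ε, hθ, rfl⟩ ?_
  rintro _ ⟨β, ε, hθ, rfl⟩
  exact sInf_sharpErrorBound_le_errorBound hk hβ' hθ

end Conclusion

end GrowingADA

end

theorem mainTheorem12_general (X : Type u) [Countable X] [MeasurableSpace X]
    [MeasurableSingletonClass X] (n₀ n k : ℕ) (hn₀ : 1 ≤ n₀) (hk : 1 ≤ k) (β' : ℝ) (hβ' : 0 < β')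
    (σ : ℝ) (sigma : ℕ → ℝ) (hσ : ∀ t, 0 < sigma t ∧ sigma t ≤ σ) (ρ : ℝ) (hρ : 0 ≤ ρ) :
    GrowingADA.IsDistributionallyAccurate.{u, v} X n₀ n k sigma ρ
      (sInf {a | ∃ β ε : ℝ, (σ, β, ε) ∈ GrowingADA.paramSet ∧
        a = GrowingADA.sharpErrorBound n₀ n k ρ β' σ β ε}) β' := by
  obtain ⟨β, ε, hθ⟩ := GrowingADA.exists_mem_paramSet ((hσ 0).1.trans_le (hσ 0).2)
  refine GrowingADA.isDistributionallyAccurate_sInf ⟨_, β, ε, hθ, rfl⟩ ?_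
  rintro _ ⟨β, ε, hθ, rfl⟩
  exact GrowingADA.isDistributionallyAccurate_sharpErrorBound hn₀ hk hσ hρ hβ' hθ

theorem mainTheorem12 (X : Type u) [Finite X] [MeasurableSpace X]
    [MeasurableSingletonClass X] (n₀ n k : ℕ) (hn₀ : 1 ≤ n₀) (hn : n₀ ≤ n) (hk : 1 ≤ k)
    (β' : ℝ) (hβ'0 : 0 < β') (hβ'1 : β' < 1) (ρ : ℝ → ℝ) (hρ : ∀ σ, 0 < σ → 0 ≤ ρ σ) :
    (∀ σ : ℝ, 0 < σ →
      GrowingADA.IsDistributionallyAccurate.{u, v} X n₀ n k (fun _ => σ) (ρ σ)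
        (sInf {a | ∃ β ε : ℝ, (σ, β, ε) ∈ GrowingADA.paramSet ∧
          a = GrowingADA.errorBound n₀ n k (ρ σ) β' σ β ε}) β') ∧
    (∀ σ β ε : ℝ, (σ, β, ε) ∈ GrowingADA.paramSet →
      IsMinOn (fun θ : ℝ × ℝ × ℝ =>
        GrowingADA.errorBound n₀ n k (ρ θ.1) β' θ.1 θ.2.1 θ.2.2) GrowingADA.paramSet (σ, β, ε) →
      GrowingADA.IsDistributionallyAccurate.{u, v} X n₀ n k (fun _ => σ) (ρ σ)
        (GrowingADA.errorBound n₀ n k (ρ σ) β' σ β ε) β') := by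
  have haccurate (σ : ℝ) (hσ : 0 < σ) := mainTheorem12_general.{u, v} X n₀ n k hn₀ hk β' hβ'0 σ
    (fun _ => σ) (fun _ => ⟨hσ, le_rfl⟩) (ρ σ) (hρ σ hσ)
  exact ⟨fun σ hσ => (haccurate σ hσ).mono
      (GrowingADA.sInf_sharpErrorBound_le_sInf_errorBound hk hβ'0.le hσ),
    fun σ β ε hθ _ => (haccurate σ hθ.1).mono
      (GrowingADA.sInf_sharpErrorBound_le_errorBound hk hβ'0.le hθ)⟩
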